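/- \textbf{Setting.} The destination $D$ is the origin of $\mathbb{R}^2$ and the source $S$ is the point $(R_{SD},0)$, $R_{SD}\ge 0$. For $Q\in\{\mathrm{RF},\mathrm{THz}\}$ the $Q$ relays $x_{Q,1},x_{Q,2},\dots$ form a homogeneous Poisson point process $\Phi_Q$ of density $\lambda_Q\ge 0$ on the disc of radius $R_C>0$ around $D$; $\Phi_{\mathrm{RF}}$ and $\Phi_{\mathrm{THz}}$ are independent. The parameters $\varepsilon_Q,G_Q,\nu_Q,\beta_Q,\sigma_Q^2,B_Q,\alpha,\mu$ are positive, $y_{th}\ge 0$, $\gamma_Q=(c/(4\pi\nu_Q))^2$ with $c=3\times10^8$, and $\tau_Q=2^{2y_{th}/B_Q}-1$. A link of length $r$ with fading $\mathcal X_Q$ has $$\mathrm{SNR}_{\mathrm{RF}}=\frac{\varepsilon_{\mathrm{RF}}G_{\mathrm{RF}}\gamma_{\mathrm{RF}}r^{-\beta_{\mathrm{RF}}}\mathcal X_{\mathrm{RF}}}{\sigma^2_{\mathrm{RF}}},\qquad \mathrm{SNR}_{\mathrm{THz}}=\frac{\varepsilon_{\mathrm{THz}}G_{\mathrm{THz}}\gamma_{\mathrm{THz}}e^{-\beta_{\mathrm{THz}}r}\mathcal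 X_{\mathrm{THz}}}{\sigma^2_{\mathrm{THz}}\,r^2}.$$ The fading variables of all links $S$--relay and relay--$D$ are mutually independent and independent of the relay positions; $\mathcal X_{\mathrm{RF}}$ is exponential with mean $1$, and $\mathbb P[\mathcal X_{\mathrm{THz}}>m]=\Gamma(\mu,\mu m^{\alpha/2})/\Gamma(\mu)$ for $m\ge 0$, where $\Gamma(\cdot,\cdot)$ is the upper incomplete Gamma function. \textbf{Protocol (HRS).} A $Q$ relay is admissible if the SNR of its link from $S$ is at least $\tau_Q$. Among the admissible relays of both bands, one with the largest average rate to $D$ is selected, where the average rate is $\frac{B_Q}{2}\log_2(1+\overline{\mathrm{SNR}})$ and $\overline{\mathrm{SNR}}$ is the SNR of the link to $D$ with the fading replaced by its average level: the mean $\mathbb E[\mathcal X_{\mathrm{RF}}]$ for RF, and the $\alpha$-root mean value $\mathbb E[\mathcal X_{\mathrm{THz}}^{\alpha/2}]^{2/\alpha}$ for THz (both equal $1$; for $\alpha=2$ the latter is the mean). The coverage probability $P^C$ is the probability that some relay is selected and that the SNR of its link to $D$ exceeds $\tau_Q$, $Q$ being its band. \textbf{Notation.} Put $$s_{\mathrm{RF}}(r)=\exp\Big(-\frac{\tau_{\mathrm{RF}}r^{\beta_{\mathrm{RF}}}\sigma^2_{\mathrm{RF}}}{\varepsilon_{\mathrm{RF}}G_{\mathrm{RF}}\gamma_{\mathrm{RF}}}\Big),\qquad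 s_{\mathrm{THz}}(r)=\frac1{\Gamma(\mu)}\Gamma\Big(\mu,\mu\Big(\frac{\tau_{\mathrm{THz}}r^2\sigma^2_{\mathrm{THz}}}{\varepsilon_{\mathrm{THz}}G_{\mathrm{THz}}\gamma_{\mathrm{THz}}e^{-\beta_{\mathrm{THz}}r}}\Big)^{\alpha/2}\Big),$$ $d(\rho,\theta)=\sqrt{\rho^2+R_{SD}^2-2\rho R_{SD}\cos\theta}$, and, for $0<r\le R_C$, $$f_{R_D,Q}(r)=r\lambda_Q\int_0^{2\pi}s_Q(d(r,\theta))\,d\theta\;\exp\Big(-\int_0^r\!\int_0^{2\pi}\lambda_Q s_Q(d(\rho,\theta))\,\rho\,d\theta\,d\rho\Big),$$ with $f_{R_D,Q}(r)=0$ otherwise. Let $$P^A_{\mathrm{RF}}(r)=1-\int_0^{R_{\mathrm{R2T}}(r)}f_{R_D,\mathrm{THz}}(\rho)\,d\rho,\qquad P^A_{\mathrm{THz}}(r)=1-\int_0^{R_{\mathrm{T2R}}(r)}f_{R_D,\mathrm{RF}}(\rho)\,d\rho,$$ $$R_{\mathrm{R2T}}(r)=\frac{2}{\beta_{\mathrm{THz}}}\mathcal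 W\Bigg(\frac{\beta_{\mathrm{THz}}}{2}\bigg(\Big(\big(1+\tfrac{\varepsilon_{\mathrm{RF}}G_{\mathrm{RF}}\gamma_{\mathrm{RF}}}{r^{\beta_{\mathrm{RF}}}\sigma^2_{\mathrm{RF}}}\big)^{B_{\mathrm{RF}}/B_{\mathrm{THz}}}-1\Big)\frac{\sigma^2_{\mathrm{THz}}}{\varepsilon_{\mathrm{THz}}G_{\mathrm{THz}}\gamma_{\mathrm{THz}}}\bigg)^{-1/2}\Bigg),$$ $$R_{\mathrm{T2R}}(r)=\bigg(\Big(\big(1+\tfrac{\varepsilon_{\mathrm{THz}}G_{\mathrm{THz}}\gamma_{\mathrm{THz}}}{r^2e^{\beta_{\mathrm{THz}}r}\sigma^2_{\mathrm{THz}}}\big)^{B_{\mathrm{THz}}/B_{\mathrm{RF}}}-1\Big)\frac{\sigma^2_{\mathrm{RF}}}{\varepsilon_{\mathrm{RF}}G_{\mathrm{RF}}\gamma_{\mathrm{RF}}}\bigg)^{-1/\beta_{\mathrm{RF}}},$$ where $\mathcal W$ is the Lambert function, the inverse of $m\mapsto me^m$ (principal branch). \textbf{Theorem.} For $Q\in\{\mathrm{RF},\mathrm{THz}\}$,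 $f_{R_D,Q}$ is the (defective) density of the distance between $D$ and its nearest admissible $Q$ relay, and $P^A_Q(r)$ is the probability that $D$ selects a $Q$ relay given that this distance is $r$; that is, for all $r\ge0$, the probability that there is an admissible $Q$ relay within distance $r$ of $D$ is $\int_0^r f_{R_D,Q}(\rho)\,d\rho$, and the probability that a $Q$ relay within distance $r$ of $D$ is selected is $\int_0^r f_{R_D,Q}(\rho)P^A_Q(\rho)\,d\rho$. The coverage probability at $D$ under the HRS protocol is $$P^C=\int_0^{R_C}f_{R_D,\mathrm{RF}}(\rho)\exp\Big(-\frac{\tau_{\mathrm{RF}}\rho^{\beta_{\mathrm{RF}}}\sigma^2_{\mathrm{RF}}}{\varepsilon_{\mathrm{RF}}G_{\mathrm{RF}}\gamma_{\mathrm{RF}}}\Big)P^A_{\mathrm{RF}}(\rho)\,d\rho$$ $$\qquad+\int_0^{R_C}f_{R_D,\mathrm{THz}}(\rho)P^A_{\mathrm{THz}}(\rho)\frac1{\Gamma(\mu)}\Gamma\Big(\mu,\mu\Big(\frac{\tau_{\mathrm{THz}}\rho^2\sigma^2_{\mathrm{THz}}}{\varepsilon_{\mathrm{THz}}G_{\mathrm{THz}}\gamma_{\mathrm{THz}}\exp(-\beta_{\mathrm{THz}}\rho)}\Big)^{\alpha/2}\Big)\,d\rho.$$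 -/

import Mathlib

open MeasureTheory ProbabilityTheory Set
open scoped NNReal ENNReal

noncomputable section

namespace HybridRelay

/-- The two frequency bands `Q`. -/
inductive Band
  | rf
  | thz

/-- The two end points `X` of a relay link: the source and the destination. -/
inductive Terminal
  | src
  | dst

/-- The other band. -/
def Band.other : Band → Band
  | .rf => .thz
  | .thz => .rf

/-- The plane that contains all nodes. -/
abbrev Plane : Type := EuclideanSpace ℝ (Fin 2)

/-! ### Special functions -/

/-- The upper incomplete Gamma function `Γ(s, x) = ∫_x^∞ t^(s-1) e^(-t) dt`. -/
def upperGamma (s x : ℝ) : ℝ :=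
  ∫ t in Ioi x, t ^ (s - 1) * Real.exp (-t)

/-- The principal branch of the Lambert function: the inverse of `m ↦ m e^m` on `[-1, ∞)`. -/
def lambertW (y : ℝ) : ℝ :=
  Function.invFunOn (fun m : ℝ => m * Real.exp m) (Ici (-1)) y

/-! ### Deterministic parameters -/

/-- The parameters of the network. -/
structure Params where
  /-- relay density `λ_Q` -/
  lam : Band → ℝ
  /-- transmitting power `ε_Q` -/
  eps : Band → ℝ
  /-- total antenna gain `G_Q` -/
  gain : Band → ℝ
  /-- carrier frequency `ν_Q` -/
  freq : Band → ℝ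
  /-- path-loss exponent `β_RF` and molecular absorption coefficient `β_THz` -/
  beta : Band → ℝ
  /-- thermal noise power `σ_Q²` -/
  noise : Band → ℝ
  /-- transmission bandwidth `B_Q` -/
  bandwidth : Band → ℝ
  /-- first parameter of the `α-μ` fading -/
  alpha : ℝ
  /-- second parameter of the `α-μ` fading -/
  mu : ℝ
  /-- desired rate `y_th` -/
  yth : ℝ
  /-- distance between source and destination -/
  RSD : ℝ
  /-- radius of the disc that contains the relays -/
  RC : ℝ

/-- The admissible range of the parameters. -/
structure Params.Valid (p : Params) : Prop where
  lam_nonneg : ∀ Q, 0 ≤ p.lam Q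
  eps_pos : ∀ Q, 0 < p.eps Q
  gain_pos : ∀ Q, 0 < p.gain Q
  freq_pos : ∀ Q, 0 < p.freq Q
  beta_pos : ∀ Q, 0 < p.beta Q
  noise_pos : ∀ Q, 0 < p.noise Q
  bandwidth_pos : ∀ Q, 0 < p.bandwidth Q
  alpha_pos : 0 < p.alpha
  mu_pos : 0 < p.mu
  yth_nonneg : 0 ≤ p.yth
  RSD_nonneg : 0 ≤ p.RSD
  RC_pos : 0 < p.RC

namespace Params

variable (p : Params)

/-- `γ_Q = (c / (4 π ν_Q))²` with `c = 3 × 10⁸`. -/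
def gam (Q : Band) : ℝ := (3 * 10 ^ 8 / (4 * Real.pi * p.freq Q)) ^ 2

/-- The SNR threshold `τ_Q = 2^(2 y_th / B_Q) - 1`. -/
def tau (Q : Band) : ℝ := (2 : ℝ) ^ (2 * p.yth / p.bandwidth Q) - 1

/-- The path loss at distance `r`. -/
def pathLoss : Band → ℝ → ℝ
  | .rf, r => p.gam .rf * r ^ (-p.beta .rf)
  | .thz, r => p.gam .thz * Real.exp (-p.beta .thz * r) / r ^ 2

/-- The SNR of a `Q` link of length `r` with fading value `x`. -/
def snr (Q : Band) (r x : ℝ) : ℝ :=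
  p.eps Q * p.gain Q * p.pathLoss Q r * x / p.noise Q

/-- The achievable rate of a `Q` link with SNR `s`; the factor `1/2` is due to the two time
slots. -/
def rate (Q : Band) (s : ℝ) : ℝ := p.bandwidth Q / 2 * Real.logb 2 (1 + s)

/-- The destination is the origin of the plane and this is the source. -/
def srcPos : Plane := !₂[p.RSD, 0]

/-- The position of a terminal. -/
def termPos : Terminal → Plane
  | .src => p.srcPos
  | .dst => 0

/-! ### The explicit expressions -/

/-- The success probability of a `Q` link of length `r`. -/
def succProb : Band → ℝ → ℝ
  | .rf, r => Real.exp (-(p.tau .rf * r ^ p.beta .rf * p.noise .rf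
      / (p.eps .rf * p.gain .rf * p.gam .rf)))
  | .thz, r => upperGamma p.mu (p.mu * (p.tau .thz * r ^ 2 * p.noise .thz
      / (p.eps .thz * p.gain .thz * p.gam .thz * Real.exp (-p.beta .thz * r))) ^ (p.alpha / 2))
      / Real.Gamma p.mu

/-- The distance to the source of the point with polar coordinates `(ρ, θ)`. -/
def distSrc (ρ θ : ℝ) : ℝ :=
  Real.sqrt (ρ ^ 2 + p.RSD ^ 2 - 2 * ρ * p.RSD * Real.cos θ)

/-- The complementary distribution function of the distance between the destination and its
nearest admissible `Q` relay, for `0 < r ≤ R_C`. -/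
def distCCDF (Q : Band) (r : ℝ) : ℝ :=
  Real.exp (-∫ ρ in (0 : ℝ)..r, ∫ θ in (0 : ℝ)..(2 * Real.pi),
    p.lam Q * p.succProb Q (p.distSrc ρ θ) * ρ)

open Classical in
/-- The density of the distance between the destination and its nearest admissible `Q` relay. It
vanishes outside `(0, R_C]`, as there are no relays beyond distance `R_C`. -/
def distPDF (Q : Band) (r : ℝ) : ℝ :=
  if 0 < r ∧ r ≤ p.RC then
    r * p.lam Q * (∫ θ in (0 : ℝ)..(2 * Real.pi), p.succProb Q (p.distSrc r θ)) * p.distCCDF Q r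
  else 0

/-- The distance at which a relay of the other band has the same average rate as a `Q` relay at
distance `r`. -/
def switchDist : Band → ℝ → ℝ
  | .rf, r => 2 / p.beta .thz * lambertW (p.beta .thz / 2 *
      (((1 + p.eps .rf * p.gain .rf * p.gam .rf / (r ^ p.beta .rf * p.noise .rf))
          ^ (p.bandwidth .rf / p.bandwidth .thz) - 1)
        * (p.noise .thz / (p.eps .thz * p.gain .thz * p.gam .thz))) ^ (-(1 / 2) : ℝ))
  | .thz, r =>
      (((1 + p.eps .thz * p.gain .thz * p.gam .thz
            / (r ^ 2 * Real.exp (p.beta .thz * r) * p.noise .thz))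
          ^ (p.bandwidth .thz / p.bandwidth .rf) - 1)
        * (p.noise .rf / (p.eps .rf * p.gain .rf * p.gam .rf))) ^ (-(1 / p.beta .rf))

/-- The probability that the destination is associated with its nearest admissible `Q` relay,
given that this relay is at distance `r`. -/
def assocProb (Q : Band) (r : ℝ) : ℝ :=
  1 - ∫ ρ in (0 : ℝ)..p.switchDist Q r, p.distPDF Q.other ρ

end Params

/-! ### The random network -/

/-- The number of points of the finite configuration `x 0, …, x (n - 1)` that lie in `A`. -/
def countIn {E : Type*} (A : Set E) (n : ℕ) (x : ℕ → E) : ℕ :=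
  Set.ncard {i : ℕ | i < n ∧ x i ∈ A}

/-- The random finite configuration `X 0, …, X (N - 1)` is a Poisson point process with the
finite intensity measure `Λ`: counts in measurable sets are Poisson distributed with mean `Λ A`,
and counts in disjoint sets are independent. -/
structure IsPoissonPointProcess {Ω E : Type*} [MeasurableSpace Ω] [MeasurableSpace E]
    (P : Measure Ω) (N : Ω → ℕ) (X : ℕ → Ω → E) (Λ : Measure E) : Prop where
  measurable_num : Measurable N
  measurable_pos : ∀ i, Measurable (X i)
  poisson : ∀ A : Set E, MeasurableSet A →
    P.map (fun ω => countIn A (N ω) (fun i => X i ω)) = poissonMeasure (Λ A).toNNReal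
  indep : ∀ (n : ℕ) (A : Fin n → Set E), (∀ j, MeasurableSet (A j)) →
    Pairwise (fun j k => Disjoint (A j) (A k)) →
    iIndepFun (fun (j : Fin n) ω => countIn (A j) (N ω) (fun i => X i ω)) P

/-- The random elements of the network: in band `Q` there are `num Q` relays with positions
`pos Q i`, `i < num Q`, and `fade Q T i` is the fading between the `i`-th relay and `T`. -/
structure Network (Ω : Type*) where
  num : Band → Ω → ℕ
  pos : Band → ℕ → Ω → Plane
  fade : Band → Terminal → ℕ → Ω → ℝ

/-- The probabilistic assumptions on the network. -/
structure Network.IsModel {Ω : Type*} [MeasurableSpace Ω] (net : Network Ω) (p : Params)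
    (P : Measure Ω) : Prop where
  /-- The relays of each band form a homogeneous Poisson process on the disc. -/
  ppp : ∀ Q, IsPoissonPointProcess P (net.num Q) (net.pos Q)
    (ENNReal.ofReal (p.lam Q) • volume.restrict (Metric.closedBall (0 : Plane) p.RC))
  measurable_fade : ∀ Q T i, Measurable (net.fade Q T i)
  /-- RF fading is exponential with unit mean. -/
  fade_rf : ∀ T i, P.map (net.fade .rf T i) = expMeasure 1
  /-- THz fading is `α-μ` distributed, which is expressed by its complementary distribution
  function. -/
  fade_thz : ∀ T i, ∀ m : ℝ, 0 ≤ m → P.real {ω | m < net.fade .thz T i ω} =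
    upperGamma p.mu (p.mu * m ^ (p.alpha / 2)) / Real.Gamma p.mu
  /-- The fading variables of all links are mutually independent. -/
  indep_fade : iIndepFun
    (fun k : Band × Terminal × ℕ => net.fade k.1 k.2.1 k.2.2) P
  /-- The RF and the THz relay processes are independent. -/
  indep_pos : IndepFun (fun ω => (net.num .rf ω, fun i => net.pos .rf i ω))
    (fun ω => (net.num .thz ω, fun i => net.pos .thz i ω)) P
  /-- Relay positions and fading are independent. -/
  indep_pos_fade : IndepFun (fun ω (Q : Band) => (net.num Q ω, fun i => net.pos Q i ω))
    (fun ω (Q : Band) (T : Terminal) (i : ℕ) => net.fade Q T i ω) P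

namespace Network

variable {Ω : Type*} [MeasurableSpace Ω] (net : Network Ω) (p : Params) (P : Measure Ω)

/-- The instantaneous SNR of the link between the `i`-th relay of band `Q` and `T`. -/
def linkSNR (Q : Band) (T : Terminal) (i : ℕ) (ω : Ω) : ℝ :=
  p.snr Q (dist (net.pos Q i ω) (p.termPos T)) (net.fade Q T i ω)

/-- The `i`-th relay of band `Q` is admissible: its SNR from the source reaches `τ_Q`. -/
def Admissible (Q : Band) (i : ℕ) (ω : Ω) : Prop :=
  i < net.num Q ω ∧ p.tau Q ≤ net.linkSNR p Q .src i ω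

/-- The average level of the fading between the `i`-th relay of band `Q` and the destination: the
mean for the exponential law, the `α`-root mean value `E[x^(α/2)]^(2/α)` for the `α-μ` law. -/
def avgFade : Band → ℕ → ℝ
  | .rf, i => ∫ ω, net.fade .rf .dst i ω ∂P
  | .thz, i => (∫ ω, net.fade .thz .dst i ω ^ (p.alpha / 2) ∂P) ^ (2 / p.alpha)

/-- The average rate between the `i`-th relay of band `Q` and the destination: the rate at the
average SNR, given the position of the relay. -/
def avgRate (Q : Band) (i : ℕ) (ω : Ω) : ℝ :=
  p.rate Q (p.snr Q (dist (net.pos Q i ω) (p.termPos .dst)) (net.avgFade p P Q i))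

/-- The `i`-th relay of band `Q` is selected: it is admissible, and no admissible relay of either
band has a larger average rate with the destination. -/
def Selected (Q : Band) (i : ℕ) (ω : Ω) : Prop :=
  net.Admissible p Q i ω ∧
    ∀ (Q' : Band) (j : ℕ), net.Admissible p Q' j ω →
      net.avgRate p P Q' j ω ≤ net.avgRate p P Q i ω

/-- Coverage: the SNR at the destination from the selected relay exceeds the threshold. -/
def Covered (ω : Ω) : Prop :=
  ∃ (Q : Band) (i : ℕ), net.Selected p P Q i ω ∧ p.tau Q < net.linkSNR p Q .dst i ω

end Network

end HybridRelay

end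

/-!
For each band `Q` let `D_Q` (`Network.admDist`) be the distance from the destination to its
nearest admissible `Q` relay, with `D_Q = ∞` if there is none. Everything follows from the laws of
`D_rf` and `D_thz` and from their independence.

*Law of `D_Q`.* Given the positions of the relays, they are admissible independently of each
other, a relay at `x` with the probability `s_Q(|x - S|)`. Hence the probability that no
admissible relay lies within distance `r` is the expectation of a product over the points of a
Poisson process. By the generating functional (`integral_prod_poisson`) this is the exponential of
minus the integral of `λ_Q s_Q(|x - S|)` over the disc of radius `min r R_C`, and polar
coordinates turn it into `distCCDF` (`measure_lt_admDist`). Since `distPDF` is minus its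
derivative, `D_Q` has the defective density `distPDF` (`map_admDist`). The labels of the relays
play no role in this.

*Selection.* Both kinds of fading have average level `1` (`avgFade_eq_one`), so the average rate
of a link is a strictly decreasing function of its length, and a `Q` relay at distance `ρ` has at
least the average rate of a relay of the other band at distance `ρ'` if and only if `ρ'` is at
least `switchDist Q ρ` (`meanRate_le_iff`). So almost surely a selected `Q` relay is the nearest
admissible one, and it is selected if and only if the nearest admissible relay of the other band
is farther than `switchDist Q D_Q` (`selected_iff`). As the two distances are independent and have
no finite atoms, integrating out the other band yields the factor `assocProb`
(`lintegral_bandSelected`).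

*Coverage.* Which relay is selected depends only on the positions and on the fading at the source,
both independent of the fading at the destination. So the link from the selected relay succeeds
with the conditional probability `s_Q(D_Q)` (`measure_relaySelected_inter`). To sum over the
possible labels of the selected relay one needs that it is almost surely unique: no two relays of
a band are at the same positive distance (`ae_dist_injective`), and the nearest admissible relays
of the two bands have different average rates (`aedisjoint_bandSelected`).
-/

noncomputable section

namespace HybridRelay

/-! ### Independence -/

section Independence

variable {Ω : Type*} [MeasurableSpace Ω] {P : Measure Ω} [IsProbabilityMeasure P]

/-- If `A` is independent of `(B, C)` and `B` is independent of `C`, then all three are independent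
and can be regrouped. -/
lemma indepFun_prodMk_of_indepFun_prodMk {α β γ : Type*} [MeasurableSpace α] [MeasurableSpace β]
    [MeasurableSpace γ] {A : Ω → α} {B : Ω → β} {C : Ω → γ} (hA : Measurable A)
    (hB : Measurable B) (hC : Measurable C) (h : IndepFun A (fun ω => (B ω, C ω)) P)
    (h' : IndepFun B C P) : IndepFun (fun ω => (A ω, B ω)) C P := by
  have hAB : IndepFun A B P := h.comp measurable_id measurable_fst
  rw [indepFun_iff_map_prod_eq_prod_map_map (hA.prodMk hB).aemeasurable hC.aemeasurable,
    (indepFun_iff_map_prod_eq_prod_map_map hA.aemeasurable hB.aemeasurable).1 hAB]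
  have h1 := (indepFun_iff_map_prod_eq_prod_map_map hA.aemeasurable
    (hB.prodMk hC).aemeasurable).1 h
  rw [(indepFun_iff_map_prod_eq_prod_map_map hB.aemeasurable hC.aemeasurable).1 h'] at h1
  have := Measure.isProbabilityMeasure_map (μ := P) hA.aemeasurable
  have := Measure.isProbabilityMeasure_map (μ := P) hB.aemeasurable
  have := Measure.isProbabilityMeasure_map (μ := P) hC.aemeasurable
  have h2 : P.map (fun ω => ((A ω, B ω), C ω))
      = (P.map (fun ω => (A ω, (B ω, C ω)))).map MeasurableEquiv.prodAssoc.symm := by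
    rw [Measure.map_map MeasurableEquiv.prodAssoc.symm.measurable (hA.prodMk (hB.prodMk hC))]
    rfl
  rw [h2, h1]
  exact (MeasurePreserving.symm _ (measurePreserving_prodAssoc _ _ _)).map_eq

/-- Fubini for two independent variables: the second may be integrated out over an independent
copy of the probability space. -/
lemma lintegral_comp_prodMk_of_indepFun {α β : Type*} [MeasurableSpace α] [MeasurableSpace β]
    {A : Ω → α} {B : Ω → β} (hA : Measurable A) (hB : Measurable B) (h : IndepFun A B P)
    {φ : α × β → ℝ≥0∞} (hφ : Measurable φ) :
    ∫⁻ ω, φ (A ω, B ω) ∂P = ∫⁻ ω, ∫⁻ ω', φ (A ω, B ω') ∂P ∂P := by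
  have := Measure.isProbabilityMeasure_map (μ := P) hA.aemeasurable
  have := Measure.isProbabilityMeasure_map (μ := P) hB.aemeasurable
  have h1 : ∫⁻ ω, φ (A ω, B ω) ∂P = ∫⁻ z, φ z ∂(P.map fun ω => (A ω, B ω)) :=
    (lintegral_map hφ (hA.prodMk hB)).symm
  rw [h1, (indepFun_iff_map_prod_eq_prod_map_map hA.aemeasurable hB.aemeasurable).1 h,
    lintegral_prod _ hφ.aemeasurable, lintegral_map hφ.lintegral_prod_right' hA]
  refine lintegral_congr fun ω => ?_
  exact lintegral_map (hφ.comp measurable_prodMk_left) hB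

lemma measure_prodMk_mem_of_indepFun {α β : Type*} [MeasurableSpace α] [MeasurableSpace β]
    {A : Ω → α} {B : Ω → β} (hA : Measurable A) (hB : Measurable B) (h : IndepFun A B P)
    {S : Set (α × β)} (hS : MeasurableSet S) :
    P {ω | (A ω, B ω) ∈ S} = ∫⁻ ω, P {ω' | (A ω, B ω') ∈ S} ∂P := by
  have h1 := lintegral_comp_prodMk_of_indepFun hA hB h
    (measurable_const (a := (1 : ℝ≥0∞)).indicator hS)
  have h2 : ∀ {f : Ω → α × β}, Measurable f →
      ∫⁻ ω, S.indicator (fun _ => (1 : ℝ≥0∞)) (f ω) ∂P = P {ω | f ω ∈ S} := fun {f} hf => by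
    rw [show (fun ω => S.indicator (fun _ => (1 : ℝ≥0∞)) (f ω))
      = (f ⁻¹' S).indicator 1 from rfl, lintegral_indicator_one (hf hS)]
    rfl
  rw [h2 (hA.prodMk hB)] at h1
  rw [h1]
  exact lintegral_congr fun ω => h2 (measurable_const.prodMk hB)

end Independence

/-! ### The generating functional of a Poisson process -/

section Poisson

lemma integral_pow_poissonMeasure (l : ℝ≥0) (v : ℝ) :
    ∫ k, v ^ k ∂poissonMeasure l = Real.exp (-(l * (1 - v))) := by
  rw [integral_poissonMeasure]
  have h := (NormedSpace.expSeries_div_hasSum_exp (𝔸 := ℝ) (l * v)).mul_left (Real.exp (-l))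
  rw [← Real.exp_eq_exp_ℝ, ← Real.exp_add] at h
  rw [show -(l * (1 - v)) = -(l : ℝ) + l * v by ring, ← h.tsum_eq]
  refine tsum_congr fun k => ?_
  rw [smul_eq_mul, mul_pow]
  ring

lemma countIn_eq_card {E : Type*} (A : Set E) [DecidablePred (· ∈ A)] (n : ℕ) (x : ℕ → E) :
    countIn A n x = (Finset.filter (fun i => x i ∈ A) (Finset.range n)).card := by
  rw [countIn, ← Set.ncard_coe_finset]
  congr 1
  ext i
  simp

variable {Ω E : Type*} [MeasurableSpace Ω] [MeasurableSpace E] {P : Measure Ω}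
  [IsProbabilityMeasure P] {N : Ω → ℕ} {X : ℕ → Ω → E} {Λ : Measure E}

lemma measurable_countIn (hN : Measurable N) (hX : ∀ i, Measurable (X i)) {A : Set E}
    (hA : MeasurableSet A) : Measurable fun ω => countIn A (N ω) (fun i => X i ω) := by
  classical
  simp only [countIn_eq_card]
  have : (fun ω => (Finset.filter (fun i => X i ω ∈ A) (Finset.range (N ω))).card)
      = fun ω => ∑ i ∈ Finset.range (N ω), A.indicator (fun _ => 1) (X i ω) := by
    funext ω
    rw [Finset.card_filter]
    rfl
  rw [this]
  have h : ∀ n, Measurable fun ω => ∑ i ∈ Finset.range n, A.indicator (fun _ => 1) (X i ω) :=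
    fun n => Finset.measurable_fun_sum _ fun i _ => (measurable_const.indicator hA).comp (hX i)
  exact (measurable_from_prod_countable_right (f := fun q : ℕ × Ω =>
    ∑ i ∈ Finset.range q.1, A.indicator (fun _ => 1) (X i q.2)) h).comp (hN.prodMk measurable_id)

lemma measurable_prod_range (hN : Measurable N) (hX : ∀ i, Measurable (X i)) {g : E → ℝ}
    (hg : Measurable g) : Measurable fun ω => ∏ i ∈ Finset.range (N ω), g (X i ω) := by
  have h : ∀ n, Measurable fun ω => ∏ i ∈ Finset.range n, g (X i ω) :=
    fun n => Finset.measurable_fun_prod _ fun i _ => hg.comp (hX i)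
  exact (measurable_from_prod_countable_right (f := fun q : ℕ × Ω =>
    ∏ i ∈ Finset.range q.1, g (X i q.2)) h).comp (hN.prodMk measurable_id)

/-- For a simple function the product over the points depends on the counts in its level sets
only. -/
lemma prod_range_simpleFunc (g : SimpleFunc E ℝ) (n : ℕ) (x : ℕ → E) :
    ∏ i ∈ Finset.range n, g (x i) = ∏ v ∈ g.range, v ^ countIn (g ⁻¹' {v}) n x := by
  classical
  rw [← Finset.prod_fiberwise_of_maps_to (t := g.range) (g := fun i => g (x i))
    (fun i _ => g.mem_range_self _)]
  refine Finset.prod_congr rfl fun v _ => ?_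
  rw [countIn_eq_card, ← Finset.prod_const]
  exact Finset.prod_congr rfl fun i hi => (Finset.mem_filter.1 hi).2

omit [IsProbabilityMeasure P] in
lemma integral_prod_simpleFunc [IsFiniteMeasure Λ] (h : IsPoissonPointProcess P N X Λ)
    (g : SimpleFunc E ℝ) :
    ∫ ω, ∏ i ∈ Finset.range (N ω), g (X i ω) ∂P = Real.exp (-∫ x, (1 - g x) ∂Λ) := by
  classical
  let e := g.range.equivFin
  let A : Fin g.range.card → Set E := fun j => g ⁻¹' {((e.symm j : g.range) : ℝ)}
  have hA : ∀ j, MeasurableSet (A j) := fun j => g.measurableSet_fiber _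
  have hdisj : Pairwise fun j k => Disjoint (A j) (A k) := by
    intro j k hjk
    refine Disjoint.preimage _ (Set.disjoint_singleton.2 fun hh => hjk ?_)
    exact e.symm.injective (Subtype.ext hh)
  have hprod : ∀ f : ℝ → ℝ, ∏ v ∈ g.range, f v = ∏ j, f (e.symm j : g.range) := fun f => by
    rw [← Finset.prod_coe_sort, ← e.symm.prod_comp]
  have hmeas := fun j => measurable_countIn h.measurable_num h.measurable_pos (hA j)
  calc ∫ ω, ∏ i ∈ Finset.range (N ω), g (X i ω) ∂P
      = ∫ ω, ∏ j, ((e.symm j : g.range) : ℝ) ^ countIn (A j) (N ω) (fun i => X i ω) ∂P := by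
        refine integral_congr_ae (ae_of_all _ fun ω => ?_)
        simp only
        rw [prod_range_simpleFunc g (N ω) fun i => X i ω]
        exact hprod fun v => v ^ countIn (g ⁻¹' {v}) (N ω) fun i => X i ω
    _ = ∏ j, ∫ ω, ((e.symm j : g.range) : ℝ) ^ countIn (A j) (N ω) (fun i => X i ω) ∂P := by
        have := (h.indep _ A hA hdisj).integral_fun_prod_comp
          (f := fun j k => ((e.symm j : g.range) : ℝ) ^ k) (fun j => (hmeas j).aemeasurable)
          (fun j => (measurable_of_countable _).aestronglyMeasurable)
        exact this
    _ = ∏ j, Real.exp (-(Λ.real (A j) * (1 - (e.symm j : g.range)))) := by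
        refine Finset.prod_congr rfl fun j _ => ?_
        have h1 := integral_map (μ := P) (hmeas j).aemeasurable
          (f := fun k : ℕ => ((e.symm j : g.range) : ℝ) ^ k)
          (measurable_of_countable _).aestronglyMeasurable
        rw [← h1, h.poisson _ (hA j), integral_pow_poissonMeasure]
        rfl
    _ = Real.exp (-∫ x, (1 - g x) ∂Λ) := by
        rw [← Real.exp_sum, Finset.sum_neg_distrib]
        congr 2
        have h2 : ∫ x, (1 - g x) ∂Λ = ∑ v ∈ g.range, Λ.real (g ⁻¹' {v}) * (1 - v) := by
          have hi := SimpleFunc.integrable_of_isFiniteMeasure (μ := Λ) g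
          have h3 := SimpleFunc.sum_range_measure_preimage_singleton g Λ
          have h4 : Λ.real univ = ∑ v ∈ g.range, Λ.real (g ⁻¹' {v}) := by
            rw [measureReal_def, ← h3, ENNReal.toReal_sum fun _ _ => measure_ne_top _ _]
            rfl
          rw [integral_sub (integrable_const _) hi, ← SimpleFunc.integral_eq_integral _ hi,
            SimpleFunc.integral_eq, integral_const, h4]
          simp [mul_sub]
        rw [h2, ← Finset.sum_coe_sort g.range, ← e.symm.sum_comp]

/-- The probability generating functional of a Poisson process: the formula for simple functions
passes to the limit by dominated convergence. -/
theorem integral_prod_poisson [IsFiniteMeasure Λ] (h : IsPoissonPointProcess P N X Λ)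
    {g : E → ℝ} (hg : Measurable g) (hg1 : ∀ x, |g x| ≤ 1) :
    ∫ ω, ∏ i ∈ Finset.range (N ω), g (X i ω) ∂P = Real.exp (-∫ x, (1 - g x) ∂Λ) := by
  have hs := hg.stronglyMeasurable
  let G := fun n => hs.approxBounded 1 n
  have hG : ∀ x, Filter.Tendsto (fun n => G n x) Filter.atTop (nhds (g x)) :=
    fun x => hs.tendsto_approxBounded_of_norm_le (hg1 x)
  have hG1 : ∀ n x, |G n x| ≤ 1 := fun n x => hs.norm_approxBounded_le zero_le_one n x
  have hl : Filter.Tendsto (fun n => ∫ ω, ∏ i ∈ Finset.range (N ω), G n (X i ω) ∂P) Filter.atTop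
      (nhds (∫ ω, ∏ i ∈ Finset.range (N ω), g (X i ω) ∂P)) := by
    refine tendsto_integral_of_dominated_convergence (fun _ => 1)
      (fun n => (measurable_prod_range h.measurable_num h.measurable_pos
        (G n).measurable).aestronglyMeasurable) (integrable_const _)
      (fun n => ae_of_all _ fun ω => ?_) (ae_of_all _ fun ω => tendsto_finsetProd _ fun i _ => hG _)
    rw [Real.norm_eq_abs, Finset.abs_prod]
    exact Finset.prod_le_one (fun _ _ => abs_nonneg _) fun i _ => hG1 n _
  have hr : Filter.Tendsto (fun n => ∫ x, (1 - G n x) ∂Λ) Filter.atTop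
      (nhds (∫ x, (1 - g x) ∂Λ)) := by
    refine tendsto_integral_of_dominated_convergence (fun _ => 2)
      (fun n => (measurable_const.sub (G n).measurable).aestronglyMeasurable) (integrable_const _)
      (fun n => ae_of_all _ fun x => ?_)
      (ae_of_all _ fun x => tendsto_const_nhds.sub (hG _))
    have := abs_le.1 (hG1 n x)
    rw [Real.norm_eq_abs, abs_le]
    constructor <;> linarith
  refine tendsto_nhds_unique hl ?_
  simp only [integral_prod_simpleFunc h]
  exact (Real.continuous_exp.tendsto _).comp hr.neg

end Poisson

/-! ### Special functions -/

section Special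

variable {s : ℝ}

lemma integrableOn_rpow_mul_exp_neg (hs : 0 < s) :
    IntegrableOn (fun t : ℝ => t ^ (s - 1) * Real.exp (-t)) (Ioi 0) := by
  simpa [mul_comm] using Real.GammaIntegral_convergent hs

lemma upperGamma_zero (hs : 0 < s) : upperGamma s 0 = Real.Gamma s := by
  rw [upperGamma, Real.Gamma_eq_integral hs]
  simp [mul_comm]

lemma upperGamma_nonneg {x : ℝ} (hx : 0 ≤ x) : 0 ≤ upperGamma s x :=
  setIntegral_nonneg measurableSet_Ioi fun _ ht =>
    mul_nonneg (Real.rpow_nonneg (hx.trans (le_of_lt ht)) _) (Real.exp_pos _).le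

lemma continuousOn_upperGamma (hs : 0 < s) : ContinuousOn (upperGamma s) (Ici 0) := by
  set F : ℝ → ℝ := (Ioi 0).indicator fun t : ℝ => t ^ (s - 1) * Real.exp (-t) with hF
  have hFi : Integrable F := (integrable_indicator_iff measurableSet_Ioi).2
    (integrableOn_rpow_mul_exp_neg hs)
  have hc : Continuous fun x => (∫ t, F t) - ∫ t in Iic x, F t := by
    have h1 : ∀ x, ∫ t in Iic x, F t = (∫ t in Iic 0, F t) + ∫ t in (0 : ℝ)..x, F t := fun x => by
      rw [← intervalIntegral.integral_Iic_sub_Iic hFi.integrableOn hFi.integrableOn]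
      ring
    rw [show (fun x => (∫ t, F t) - ∫ t in Iic x, F t) = fun x => (∫ t, F t) -
      ((∫ t in Iic 0, F t) + ∫ t in (0 : ℝ)..x, F t) from funext fun x => by rw [h1 x]]
    exact continuous_const.sub (continuous_const.add
      (intervalIntegral.continuous_primitive (fun a b => hFi.intervalIntegrable) 0))
  refine hc.continuousOn.congr fun x hx => ?_
  have h2 := integral_add_compl (measurableSet_Iic (a := x)) hFi
  rw [compl_Iic] at h2
  simp only
  rw [← h2, add_sub_cancel_left, upperGamma, hF]
  refine setIntegral_congr_fun measurableSet_Ioi fun t ht => ?_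
  have ht0 : t ∈ Ioi (0 : ℝ) := lt_of_le_of_lt (mem_Ici.1 hx) ht
  simp only [Set.indicator_of_mem ht0]

lemma upperGamma_le_Gamma (hs : 0 < s) {x : ℝ} (hx : 0 ≤ x) : upperGamma s x ≤ Real.Gamma s := by
  rw [← upperGamma_zero hs]
  refine setIntegral_mono_set (integrableOn_rpow_mul_exp_neg hs) ?_ (Ioi_subset_Ioi hx).eventuallyLE
  exact (ae_restrict_mem measurableSet_Ioi).mono fun t ht =>
    mul_nonneg (Real.rpow_nonneg (le_of_lt ht) _) (Real.exp_pos _).le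

/-- At positive arguments `m e^m = y` has a solution with `m ≥ -1`, by the intermediate value
theorem on `[0, y]`; so `lambertW` is a genuine value and not the default of `invFunOn`. -/
lemma lambertW_spec {y : ℝ} (hy : 0 < y) :
    0 < lambertW y ∧ lambertW y * Real.exp (lambertW y) = y := by
  have hmem : y ∈ (fun m : ℝ => m * Real.exp m) '' Ici (-1) := by
    have h := intermediate_value_Icc (f := fun m : ℝ => m * Real.exp m) hy.le
      (by fun_prop : Continuous fun m : ℝ => m * Real.exp m).continuousOn
    have h1 : y ∈ Icc (0 * Real.exp 0) (y * Real.exp y) :=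
      ⟨by simpa using hy.le, le_mul_of_one_le_right hy.le (Real.one_le_exp hy.le)⟩
    obtain ⟨m, hm, hm'⟩ := h h1
    exact ⟨m, by simp only [mem_Ici]; linarith [hm.1], hm'⟩
  have h2 : lambertW y * Real.exp (lambertW y) = y := Function.invFunOn_eq hmem
  refine ⟨?_, h2⟩
  by_contra hle
  have := mul_nonpos_of_nonpos_of_nonneg (not_lt.1 hle) (Real.exp_pos (lambertW y)).le
  linarith

end Special

namespace Params

variable {p : Params}

/-! ### Link success probabilities and average rates -/

/-- The constant `ε_Q G_Q γ_Q` in the SNR. -/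
def linkGain (p : Params) (Q : Band) : ℝ := p.eps Q * p.gain Q * p.gam Q

/-- The fading value at which the SNR of a `Q` link of length `r > 0` equals `τ_Q`. -/
def fadeThreshold (p : Params) : Band → ℝ → ℝ
  | .rf, r => p.tau .rf * r ^ p.beta .rf * p.noise .rf / p.linkGain .rf
  | .thz, r => p.tau .thz * r ^ 2 * p.noise .thz
      / (p.linkGain .thz * Real.exp (-p.beta .thz * r))

/-- The complementary distribution function of the fading at nonnegative arguments. -/
def fadeCCDF (p : Params) : Band → ℝ → ℝ
  | .rf, m => Real.exp (-m)
  | .thz, m => upperGamma p.mu (p.mu * m ^ (p.alpha / 2)) / Real.Gamma p.mu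

/-- The SNR of a `Q` link of length `r` at the average level `1` of the fading. -/
def meanSNR (p : Params) (Q : Band) (r : ℝ) : ℝ := p.snr Q r 1

/-- The average rate of a `Q` link of length `r`. -/
def meanRate (p : Params) (Q : Band) (r : ℝ) : ℝ := p.rate Q (p.meanSNR Q r)

lemma succProb_eq (Q : Band) (r : ℝ) : p.succProb Q r = p.fadeCCDF Q (p.fadeThreshold Q r) := by
  cases Q <;> rfl

lemma snr_eq (Q : Band) (r x : ℝ) : p.snr Q r x = p.meanSNR Q r * x := by
  simp only [meanSNR, snr]
  ring

lemma meanSNR_rf {r : ℝ} (hr : 0 < r) :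
    p.meanSNR .rf r = p.linkGain .rf / (r ^ p.beta .rf * p.noise .rf) := by
  rw [meanSNR, snr, pathLoss, linkGain, Real.rpow_neg hr.le, div_mul_eq_div_div]
  ring

lemma meanSNR_thz (r : ℝ) :
    p.meanSNR .thz r = p.linkGain .thz / (r ^ 2 * Real.exp (p.beta .thz * r) * p.noise .thz) := by
  rw [meanSNR, snr, pathLoss, linkGain, neg_mul, Real.exp_neg, div_mul_eq_div_div,
    div_mul_eq_div_div]
  ring

namespace Valid

variable (hp : p.Valid)
include hp

lemma linkGain_pos (Q : Band) : 0 < p.linkGain Q := by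
  have := hp.freq_pos Q
  have : 0 < p.gam Q := by
    unfold gam
    positivity
  exact mul_pos (mul_pos (hp.eps_pos Q) (hp.gain_pos Q)) this

lemma tau_nonneg (Q : Band) : 0 ≤ p.tau Q :=
  sub_nonneg.2 (Real.one_le_rpow one_le_two
    (div_nonneg (mul_nonneg zero_le_two hp.yth_nonneg) (hp.bandwidth_pos Q).le))

lemma fadeThreshold_nonneg (Q : Band) {r : ℝ} (hr : 0 ≤ r) : 0 ≤ p.fadeThreshold Q r := by
  have h1 := hp.linkGain_pos Q
  have h2 := hp.tau_nonneg Q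
  have h3 := hp.noise_pos Q
  cases Q <;> simp only [fadeThreshold] <;> positivity

lemma continuous_fadeThreshold (Q : Band) : Continuous (p.fadeThreshold Q) := by
  have h1 := (hp.linkGain_pos Q).ne'
  cases Q
  · exact ((continuous_const.mul (Real.continuous_rpow_const (hp.beta_pos _).le)).mul
      continuous_const).div_const _
  · exact ((continuous_const.mul (continuous_pow 2)).mul continuous_const).div (by fun_prop)
      fun r => mul_ne_zero h1 (Real.exp_ne_zero _)

lemma continuousOn_fadeCCDF (Q : Band) : ContinuousOn (p.fadeCCDF Q) (Ici 0) := by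
  cases Q
  · exact (by fun_prop : Continuous fun m : ℝ => Real.exp (-m)).continuousOn
  · refine ((continuousOn_upperGamma hp.mu_pos).comp ?_ ?_).div_const _
    · exact (continuous_const.mul
        (Real.continuous_rpow_const (by linarith [hp.alpha_pos]))).continuousOn
    · exact fun m hm => mul_nonneg hp.mu_pos.le (Real.rpow_nonneg hm _)

lemma fadeCCDF_mem_Icc (Q : Band) {m : ℝ} (hm : 0 ≤ m) : p.fadeCCDF Q m ∈ Icc (0 : ℝ) 1 := by
  cases Q
  · exact ⟨(Real.exp_pos _).le, Real.exp_le_one_iff.2 (by linarith)⟩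
  · have h := mul_nonneg hp.mu_pos.le (Real.rpow_nonneg hm (p.alpha / 2))
    have hG := Real.Gamma_pos_of_pos hp.mu_pos
    exact ⟨div_nonneg (upperGamma_nonneg h) hG.le,
      (div_le_one hG).2 (upperGamma_le_Gamma hp.mu_pos h)⟩

lemma fadeCCDF_zero (Q : Band) : p.fadeCCDF Q 0 = 1 := by
  cases Q
  · simp [fadeCCDF]
  · have h : p.alpha / 2 ≠ 0 := by linarith [hp.alpha_pos]
    simp [fadeCCDF, Real.zero_rpow h, upperGamma_zero hp.mu_pos,
      (Real.Gamma_pos_of_pos hp.mu_pos).ne']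

lemma succProb_mem_Icc (Q : Band) {r : ℝ} (hr : 0 ≤ r) : p.succProb Q r ∈ Icc (0 : ℝ) 1 := by
  rw [succProb_eq]
  exact hp.fadeCCDF_mem_Icc Q (hp.fadeThreshold_nonneg Q hr)

lemma continuousOn_succProb (Q : Band) : ContinuousOn (p.succProb Q) (Ici 0) := by
  have h : p.succProb Q = p.fadeCCDF Q ∘ p.fadeThreshold Q := funext fun r => succProb_eq Q r
  rw [h]
  exact (hp.continuousOn_fadeCCDF Q).comp (hp.continuous_fadeThreshold Q).continuousOn
    fun r hr => hp.fadeThreshold_nonneg Q hr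

lemma continuous_succProb_comp {X : Type*} [TopologicalSpace X] (Q : Band) {f : X → ℝ}
    (hf : Continuous f) (h0 : ∀ x, 0 ≤ f x) : Continuous fun x => p.succProb Q (f x) :=
  (hp.continuousOn_succProb Q).comp_continuous hf h0

lemma meanSNR_pos (Q : Band) {r : ℝ} (hr : 0 < r) : 0 < p.meanSNR Q r := by
  have h1 := hp.linkGain_pos Q
  have h3 := hp.noise_pos Q
  cases Q
  · rw [meanSNR_rf hr]
    positivity
  · rw [meanSNR_thz]
    positivity

lemma fadeThreshold_eq (Q : Band) {r : ℝ} (hr : 0 < r) :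
    p.fadeThreshold Q r = p.tau Q / p.meanSNR Q r := by
  have h1 := (hp.linkGain_pos Q).ne'
  have h3 := (hp.noise_pos Q).ne'
  cases Q
  · rw [meanSNR_rf hr, fadeThreshold, div_div_eq_mul_div]
    ring
  · rw [meanSNR_thz, fadeThreshold, div_div_eq_mul_div, neg_mul, Real.exp_neg]
    field_simp

lemma tau_le_snr_iff (Q : Band) {r x : ℝ} (hr : 0 < r) :
    p.tau Q ≤ p.snr Q r x ↔ p.fadeThreshold Q r ≤ x := by
  rw [snr_eq, hp.fadeThreshold_eq Q hr, div_le_iff₀' (hp.meanSNR_pos Q hr)]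

lemma tau_lt_snr_iff (Q : Band) {r x : ℝ} (hr : 0 < r) :
    p.tau Q < p.snr Q r x ↔ p.fadeThreshold Q r < x := by
  rw [snr_eq, hp.fadeThreshold_eq Q hr, div_lt_iff₀' (hp.meanSNR_pos Q hr)]

lemma strictAntiOn_meanSNR (Q : Band) : StrictAntiOn (p.meanSNR Q) (Ioi 0) := by
  intro a ha b hb hab
  have ha' : 0 < a := ha
  have hb' : 0 < b := hb
  have h1 := hp.linkGain_pos Q
  have h3 := hp.noise_pos Q
  cases Q
  · rw [meanSNR_rf ha', meanSNR_rf hb']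
    have := Real.rpow_lt_rpow ha'.le hab (hp.beta_pos .rf)
    have := Real.rpow_pos_of_pos ha' (p.beta .rf)
    gcongr
  · rw [meanSNR_thz, meanSNR_thz]
    have := hp.beta_pos .thz
    gcongr

lemma strictAntiOn_meanRate (Q : Band) : StrictAntiOn (p.meanRate Q) (Ioi 0) := by
  intro a ha b hb hab
  have h := hp.strictAntiOn_meanSNR Q ha hb hab
  have h1 := hp.bandwidth_pos Q
  have h2 := hp.meanSNR_pos Q hb
  have := Real.logb_lt_logb one_lt_two (by linarith) (add_lt_add_right h 1)
  simp only [meanRate, rate]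
  gcongr

/-- `switchDist` is the distance with the same average rate in the other band. For the switch to
THz the equation reads `m e^m = y` in `m = β R / 2`, whence the Lambert function. -/
lemma meanSNR_switchDist (Q : Band) {r : ℝ} (hr : 0 < r) :
    0 < p.switchDist Q r ∧ p.meanSNR Q.other (p.switchDist Q r)
      = (1 + p.meanSNR Q r) ^ (p.bandwidth Q / p.bandwidth Q.other) - 1 := by
  have hA : 0 < (1 + p.meanSNR Q r) ^ (p.bandwidth Q / p.bandwidth Q.other) - 1 :=
    sub_pos.2 (Real.one_lt_rpow (by linarith [hp.meanSNR_pos Q hr])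
      (div_pos (hp.bandwidth_pos _) (hp.bandwidth_pos _)))
  have hK := hp.linkGain_pos Q.other
  have hn := hp.noise_pos Q.other
  have hb := hp.beta_pos Q.other
  cases Q
  · have e1 : p.switchDist .rf r = 2 / p.beta .thz * lambertW (p.beta .thz / 2 *
        (((1 + p.meanSNR .rf r) ^ (p.bandwidth .rf / p.bandwidth .thz) - 1)
          * (p.noise .thz / p.linkGain .thz)) ^ (-(1 / 2) : ℝ)) := by
      rw [meanSNR_rf hr]
      rfl
    simp only [Band.other] at hA hK hn hb ⊢
    set A := (1 + p.meanSNR .rf r) ^ (p.bandwidth .rf / p.bandwidth .thz) - 1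
    set z := A * (p.noise .thz / p.linkGain .thz) with hz
    have hz0 : 0 < z := by positivity
    have hz1 := Real.rpow_pos_of_pos hz0 (-(1 / 2))
    obtain ⟨hw, hw'⟩ := lambertW_spec (y := p.beta .thz / 2 * z ^ (-(1 / 2) : ℝ)) (by positivity)
    set w := lambertW (p.beta .thz / 2 * z ^ (-(1 / 2) : ℝ))
    have h2 : (z ^ (-(1 / 2) : ℝ)) ^ 2 = z⁻¹ := by
      rw [← Real.rpow_natCast, ← Real.rpow_mul hz0.le, ← Real.rpow_neg_one]
      norm_num
    rw [e1]
    refine ⟨by positivity, ?_⟩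
    rw [meanSNR_thz]
    have e2 : (2 / p.beta .thz * w) ^ 2 * Real.exp (p.beta .thz * (2 / p.beta .thz * w)) = z⁻¹ := by
      have e3 : p.beta .thz * (2 / p.beta .thz * w) = w + w := by
        field_simp
        ring
      rw [e3, Real.exp_add]
      calc _ = (2 / p.beta .thz) ^ 2 * (w * Real.exp w) ^ 2 := by ring
        _ = (z ^ (-(1 / 2) : ℝ)) ^ 2 := by
          rw [hw']
          field_simp
        _ = z⁻¹ := h2
    rw [e2, hz]
    field_simp
  · have e1 : p.switchDist .thz r = (((1 + p.meanSNR .thz r)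
          ^ (p.bandwidth .thz / p.bandwidth .rf) - 1)
        * (p.noise .rf / p.linkGain .rf)) ^ (-(1 / p.beta .rf)) := by
      rw [meanSNR_thz]
      rfl
    simp only [Band.other] at hA hK hn hb ⊢
    set A := (1 + p.meanSNR .thz r) ^ (p.bandwidth .thz / p.bandwidth .rf) - 1
    set z := A * (p.noise .rf / p.linkGain .rf) with hz
    have hz0 : 0 < z := by positivity
    have hz1 := Real.rpow_pos_of_pos hz0 (-(1 / p.beta .rf))
    rw [e1]
    refine ⟨hz1, ?_⟩
    rw [meanSNR_rf hz1, ← Real.rpow_mul hz0.le]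
    have : -(1 / p.beta .rf) * p.beta .rf = -1 := by field_simp
    rw [this, Real.rpow_neg_one, hz]
    field_simp

lemma meanRate_switchDist (Q : Band) {r : ℝ} (hr : 0 < r) :
    p.meanRate Q.other (p.switchDist Q r) = p.meanRate Q r := by
  have h0 := hp.meanSNR_pos Q hr
  have hb := hp.bandwidth_pos Q.other
  rw [meanRate, rate, (hp.meanSNR_switchDist Q hr).2, add_sub_cancel,
    Real.logb_rpow_eq_mul_logb_of_pos (by linarith), meanRate, rate]
  field_simp

lemma meanRate_le_iff (Q : Band) {r r' : ℝ} (hr : 0 < r) (hr' : 0 < r') :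
    p.meanRate Q.other r' ≤ p.meanRate Q r ↔ p.switchDist Q r ≤ r' := by
  rw [← hp.meanRate_switchDist Q hr]
  exact (hp.strictAntiOn_meanRate Q.other).le_iff_ge hr' (hp.meanSNR_switchDist Q hr).1

end Valid
end Params

namespace Params

/-! ### The density of the nearest admissible relay -/

variable {p : Params}

/-- The intensity of the distances of the admissible `Q` relays from the destination: the
admissible relays form a Poisson process, and this is its intensity in the radial coordinate. -/
def radialIntensity (p : Params) (Q : Band) (ρ : ℝ) : ℝ :=
  ρ * p.lam Q * ∫ θ in (0 : ℝ)..(2 * Real.pi), p.succProb Q (p.distSrc ρ θ)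

lemma distCCDF_eq (Q : Band) (r : ℝ) :
    p.distCCDF Q r = Real.exp (-∫ ρ in (0 : ℝ)..r, p.radialIntensity Q ρ) := by
  have : ∀ ρ, ∫ θ in (0 : ℝ)..(2 * Real.pi), p.lam Q * p.succProb Q (p.distSrc ρ θ) * ρ
      = p.radialIntensity Q ρ := fun ρ => by
    rw [radialIntensity, intervalIntegral.integral_mul_const,
      intervalIntegral.integral_const_mul]
    ring
  simp only [distCCDF, this]

lemma distPDF_eq_indicator (Q : Band) :
    p.distPDF Q = (Ioc 0 p.RC).indicator fun ρ => p.radialIntensity Q ρ * p.distCCDF Q ρ := by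
  classical
  funext ρ
  rw [Set.indicator_apply, distPDF]
  congr

lemma distPDF_of_nonpos (Q : Band) {ρ : ℝ} (hρ : ρ ≤ 0) : p.distPDF Q ρ = 0 :=
  if_neg fun h => absurd h.1 (not_lt.2 hρ)

lemma distSrc_eq_dist (ρ θ : ℝ) :
    p.distSrc ρ θ = dist (!₂[ρ * Real.cos θ, ρ * Real.sin θ] : Plane) p.srcPos := by
  rw [EuclideanSpace.dist_eq, distSrc]
  congr 1
  simp only [srcPos, Fin.sum_univ_two, Real.dist_eq, sq_abs]
  simp only [Matrix.cons_val_zero, Matrix.cons_val_one]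
  nlinarith [Real.sin_sq_add_cos_sq θ]

namespace Valid

variable (hp : p.Valid)
include hp

lemma continuous_succProb_distSrc (Q : Band) :
    Continuous fun q : ℝ × ℝ => p.succProb Q (p.distSrc q.1 q.2) := by
  refine hp.continuous_succProb_comp Q ?_ fun q => Real.sqrt_nonneg _
  unfold distSrc
  fun_prop

lemma continuous_radialIntensity (Q : Band) : Continuous (p.radialIntensity Q) :=
  (continuous_id.mul continuous_const).mul
    (intervalIntegral.continuous_parametric_intervalIntegral_of_continuous'
      (hp.continuous_succProb_distSrc Q) _ _)

lemma radialIntensity_nonneg (Q : Band) {ρ : ℝ} (hρ : 0 ≤ ρ) : 0 ≤ p.radialIntensity Q ρ :=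
  mul_nonneg (mul_nonneg hρ (hp.lam_nonneg Q)) (intervalIntegral.integral_nonneg
    Real.two_pi_pos.le fun _ _ => (hp.succProb_mem_Icc Q (Real.sqrt_nonneg _)).1)

lemma distPDF_nonneg (Q : Band) (ρ : ℝ) : 0 ≤ p.distPDF Q ρ := by
  unfold distPDF
  split_ifs with h
  · exact mul_nonneg (hp.radialIntensity_nonneg Q h.1.le) (Real.exp_pos _).le
  · exact le_rfl

lemma hasDerivAt_distCCDF (Q : Band) (r : ℝ) :
    HasDerivAt (p.distCCDF Q) (-(p.radialIntensity Q r * p.distCCDF Q r)) r := by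
  have h := hp.continuous_radialIntensity Q
  have h1 := (intervalIntegral.integral_hasDerivAt_right (h.intervalIntegrable 0 r)
    (h.stronglyMeasurableAtFilter _ _) h.continuousAt).neg.exp
  have h2 : p.distCCDF Q = fun r => Real.exp (-∫ ρ in (0 : ℝ)..r, p.radialIntensity Q ρ) :=
    funext fun r => distCCDF_eq Q r
  rw [h2]
  refine h1.congr_deriv ?_
  simp only [Pi.neg_apply]
  ring

lemma continuous_distCCDF (Q : Band) : Continuous (p.distCCDF Q) :=
  continuous_iff_continuousAt.2 fun r => (hp.hasDerivAt_distCCDF Q r).continuousAt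

lemma measurable_distPDF (Q : Band) : Measurable (p.distPDF Q) := by
  rw [distPDF_eq_indicator]
  exact (((hp.continuous_radialIntensity Q).mul
    (hp.continuous_distCCDF Q)).measurable).indicator measurableSet_Ioc

lemma integrable_distPDF (Q : Band) : Integrable (p.distPDF Q) := by
  rw [distPDF_eq_indicator, integrable_indicator_iff measurableSet_Ioc]
  exact (((hp.continuous_radialIntensity Q).mul
    (hp.continuous_distCCDF Q)).integrableOn_Icc).mono_set Ioc_subset_Icc_self

/-- `distPDF` is minus the derivative of `distCCDF` up to `R_C` and zero beyond. -/
lemma integral_distPDF (Q : Band) {r : ℝ} (hr : 0 ≤ r) :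
    ∫ ρ in (0 : ℝ)..r, p.distPDF Q ρ = 1 - p.distCCDF Q (min r p.RC) := by
  have hm : 0 ≤ min r p.RC := le_min hr hp.RC_pos.le
  rw [intervalIntegral.integral_of_le hr, distPDF_eq_indicator,
    setIntegral_indicator measurableSet_Ioc, Ioc_inter_Ioc, sup_idem,
    show r ⊓ p.RC = min r p.RC from rfl, ← intervalIntegral.integral_of_le hm]
  have hc := (hp.continuous_radialIntensity Q).mul (hp.continuous_distCCDF Q)
  have := intervalIntegral.integral_eq_sub_of_hasDerivAt (a := 0) (b := min r p.RC)
    (fun x _ => hp.hasDerivAt_distCCDF Q x) (hc.neg.intervalIntegrable _ _)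
  rw [intervalIntegral.integral_neg] at this
  have h0 : p.distCCDF Q 0 = 1 := by simp [distCCDF]
  linarith

lemma assocProb_eq (Q : Band) {ρ : ℝ} (hρ : 0 < ρ) :
    p.assocProb Q ρ = p.distCCDF Q.other (min (p.switchDist Q ρ) p.RC) := by
  rw [assocProb, hp.integral_distPDF Q.other (hp.meanSNR_switchDist Q hρ).1.le, sub_sub_cancel]

lemma assocProb_nonneg (Q : Band) {ρ : ℝ} (hρ : 0 < ρ) : 0 ≤ p.assocProb Q ρ := by
  rw [hp.assocProb_eq Q hρ]
  exact (Real.exp_pos _).le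

end Valid
end Params

/-! ### Polar coordinates -/

lemma integral_plane_eq_integral_prod (f : Plane → ℝ) :
    ∫ x, f x = ∫ q : ℝ × ℝ, f !₂[q.1, q.2] := by
  have h1 := (EuclideanSpace.volume_preserving_symm_measurableEquiv_toLp (Fin 2)).symm
  have h2 := (volume_preserving_finTwoArrow ℝ).symm
  rw [← h1.integral_comp', ← h2.integral_comp']
  refine integral_congr_ae (ae_of_all _ fun q => congrArg f ?_)
  ext i
  fin_cases i <;> rfl

/-- The angle of `polarCoord` runs through `(-π, π)`; periodicity moves it to `(0, 2π)`. -/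
lemma integral_closedBall_polar {f : Plane → ℝ} {R : ℝ} (hR : 0 ≤ R) {g : ℝ × ℝ → ℝ}
    (hg : Continuous g) (hper : ∀ ρ, Function.Periodic (fun θ => g (ρ, θ)) (2 * Real.pi))
    (hfg : ∀ ρ θ, f !₂[ρ * Real.cos θ, ρ * Real.sin θ] = g (ρ, θ)) :
    ∫ x in Metric.closedBall (0 : Plane) R, f x
      = ∫ ρ in (0 : ℝ)..R, ρ * ∫ θ in (0 : ℝ)..(2 * Real.pi), g (ρ, θ) := by
  rw [← integral_indicator Metric.isClosed_closedBall.measurableSet,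
    integral_plane_eq_integral_prod, ← integral_comp_polarCoord_symm]
  have hnorm : ∀ ρ θ : ℝ, 0 < ρ →
      ‖(!₂[ρ * Real.cos θ, ρ * Real.sin θ] : Plane)‖ = ρ := fun ρ θ hρ => by
    rw [EuclideanSpace.norm_eq, Fin.sum_univ_two]
    simp only [Matrix.cons_val_zero, Matrix.cons_val_one, Real.norm_eq_abs,
      sq_abs]
    rw [show (ρ * Real.cos θ) ^ 2 + (ρ * Real.sin θ) ^ 2
      = ρ ^ 2 * (Real.sin θ ^ 2 + Real.cos θ ^ 2) by ring, Real.sin_sq_add_cos_sq, mul_one,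
      Real.sqrt_sq hρ.le]
  have h1 : ∀ q ∈ polarCoord.target,
      q.1 • (Metric.closedBall (0 : Plane) R).indicator f
        !₂[(polarCoord.symm q).1, (polarCoord.symm q).2]
      = (Ioc 0 R ×ˢ Ioo (-Real.pi) Real.pi).indicator (fun q => q.1 * g q) q := by
    rintro ⟨ρ, θ⟩ ⟨hρ, hθ⟩
    simp only [polarCoord_symm_apply, smul_eq_mul]
    by_cases h : ρ ≤ R
    · rw [indicator_of_mem (by simpa [hnorm ρ θ hρ] using h),
        indicator_of_mem (show (ρ, θ) ∈ Ioc 0 R ×ˢ Ioo (-Real.pi) Real.pi from ⟨⟨hρ, h⟩, hθ⟩), hfg]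
    · rw [indicator_of_notMem (by simpa [hnorm ρ θ hρ] using h),
        indicator_of_notMem (fun hh => h hh.1.2), mul_zero]
  rw [setIntegral_congr_fun polarCoord.open_target.measurableSet h1,
    setIntegral_indicator (measurableSet_Ioc.prod measurableSet_Ioo)]
  have h2 : polarCoord.target ∩ Ioc 0 R ×ˢ Ioo (-Real.pi) Real.pi
      = Ioc 0 R ×ˢ Ioo (-Real.pi) Real.pi := by
    refine inter_eq_right.2 fun q hq => ?_
    exact ⟨hq.1.1, hq.2⟩
  have hint : IntegrableOn (fun q : ℝ × ℝ => q.1 * g q) (Ioc 0 R ×ˢ Ioo (-Real.pi) Real.pi) :=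
    ((continuous_fst.mul hg).continuousOn.integrableOn_compact
      (isCompact_Icc.prod isCompact_Icc)).mono_set
      (prod_mono Ioc_subset_Icc_self Ioo_subset_Icc_self)
  rw [h2, Measure.volume_eq_prod, setIntegral_prod _ hint, intervalIntegral.integral_of_le hR]
  refine setIntegral_congr_fun measurableSet_Ioc fun ρ _ => ?_
  simp only
  rw [integral_const_mul, ← integral_Ioc_eq_integral_Ioo,
    ← intervalIntegral.integral_of_le (by linarith [Real.pi_pos])]
  have := (hper ρ).intervalIntegral_add_eq (-Real.pi) 0
  rw [show -Real.pi + 2 * Real.pi = Real.pi by ring, zero_add] at this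
  rw [this]

namespace Params.Valid

variable {p : Params} (hp : p.Valid)
include hp

/-- The mean number of admissible `Q` relays in a disc around the destination. -/
lemma integral_succProb_closedBall (Q : Band) {R : ℝ} (hR : 0 ≤ R) :
    p.lam Q * ∫ x in Metric.closedBall (0 : Plane) R, p.succProb Q (dist x p.srcPos)
      = ∫ ρ in (0 : ℝ)..R, p.radialIntensity Q ρ := by
  rw [integral_closedBall_polar hR (hp.continuous_succProb_distSrc Q) (fun ρ θ => by
    simp [distSrc, Real.cos_add_two_pi]) (fun ρ θ => by rw [distSrc_eq_dist]),
    ← intervalIntegral.integral_const_mul]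
  refine intervalIntegral.integral_congr fun ρ _ => ?_
  simp only [radialIntensity]
  ring

end Params.Valid

/-! ### The fading -/

/-- The mean of the Gamma distribution, written as the integral of its tail. -/
lemma lintegral_upperGamma {s : ℝ} (hs : 0 < s) :
    ∫⁻ t in Ioi (0 : ℝ), ENNReal.ofReal (upperGamma s (s * t) / Real.Gamma s) = 1 := by
  set w : ℝ → ℝ := fun u => u ^ (s - 1) * Real.exp (-u) with hw
  have hwm : Measurable w := by
    rw [hw]
    fun_prop
  set ν : Measure ℝ := (volume.restrict (Ioi 0)).withDensity fun u => ENNReal.ofReal (w u)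
  have hΓ := Real.Gamma_pos_of_pos hs
  have hpos : ∀ᵐ u ∂volume.restrict (Ioi (0 : ℝ)), 0 < u := ae_restrict_mem measurableSet_Ioi
  have hν : ∀ᵐ u ∂ν, (0 : ℝ) < u := (withDensity_absolutelyContinuous _ _).ae_le hpos
  -- The layer cake formula for the function `u / s` under the density `u ^ (s - 1) * exp (-u)`.
  have h1 := lintegral_eq_lintegral_meas_lt ν (f := fun u => u / s)
    (hν.mono fun u hu => (div_pos hu hs).le) (by fun_prop)
  have h2 : ∀ t ∈ Ioi (0 : ℝ), ν {u | t < u / s} = ENNReal.ofReal (upperGamma s (s * t)) := by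
    intro t ht
    have ht0 : 0 ≤ s * t := mul_nonneg hs.le (le_of_lt ht)
    have e1 : {u : ℝ | t < u / s} = Ioi (s * t) := by
      ext u
      rw [mem_ofPred_eq, lt_div_iff₀' hs]
      rfl
    rw [e1, withDensity_apply _ measurableSet_Ioi, Measure.restrict_restrict measurableSet_Ioi,
      inter_eq_left.2 (Ioi_subset_Ioi ht0), upperGamma, ofReal_integral_eq_lintegral_ofReal]
    · exact (integrableOn_rpow_mul_exp_neg hs).mono_set (Ioi_subset_Ioi ht0)
    · exact (ae_restrict_mem measurableSet_Ioi).mono fun u hu =>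
        mul_nonneg (Real.rpow_nonneg (ht0.trans (le_of_lt hu)) _) (Real.exp_pos _).le
  have h3 : ∫⁻ u, ENNReal.ofReal (u / s) ∂ν = ENNReal.ofReal (Real.Gamma s) := by
    rw [lintegral_withDensity_eq_lintegral_mul _ (by fun_prop) (by fun_prop)]
    have h4 : ∫⁻ u in Ioi (0 : ℝ), ENNReal.ofReal (u ^ (s + 1 - 1) * Real.exp (-u) / s)
        = ENNReal.ofReal (Real.Gamma s) := by
      rw [← ofReal_integral_eq_lintegral_ofReal
        ((integrableOn_rpow_mul_exp_neg (by linarith : 0 < s + 1)).div_const s)]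
      · rw [integral_div]
        have := upperGamma_zero (by linarith : 0 < s + 1)
        rw [upperGamma, Real.Gamma_add_one hs.ne'] at this
        rw [this, mul_div_cancel_left₀ _ hs.ne']
      · exact hpos.mono fun u hu => by positivity
    rw [← h4]
    refine setLIntegral_congr_fun measurableSet_Ioi fun u hu => ?_
    have hu' : (0 : ℝ) < u := hu
    simp only [Pi.mul_apply]
    rw [← ENNReal.ofReal_mul (by positivity), hw]
    congr 1
    have : u ^ (s + 1 - 1) = u ^ (s - 1) * u := by
      rw [← Real.rpow_add_one hu'.ne']
      ring_nf
    simp only [this]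
    ring
  rw [h3, setLIntegral_congr_fun measurableSet_Ioi h2] at h1
  have h5 : ∀ t, ENNReal.ofReal (upperGamma s (s * t) / Real.Gamma s)
      = ENNReal.ofReal (upperGamma s (s * t)) * ENNReal.ofReal (Real.Gamma s)⁻¹ := fun t => by
    rw [div_eq_mul_inv, ENNReal.ofReal_mul' (inv_pos.2 hΓ).le]
  simp only [h5]
  rw [lintegral_mul_const' _ _ ENNReal.ofReal_ne_top, ← h1, ← ENNReal.ofReal_mul hΓ.le,
    mul_inv_cancel₀ hΓ.ne', ENNReal.ofReal_one]

namespace Network.IsModel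

variable {Ω : Type*} [MeasurableSpace Ω] {P : Measure Ω} [IsProbabilityMeasure P]
  {net : Network Ω} {p : Params} (hp : p.Valid) (hnet : net.IsModel p P)
include hp hnet

omit [IsProbabilityMeasure P] hp in
lemma measure_lt_fade (Q : Band) (T : Terminal) (i : ℕ) {m : ℝ} (hm : 0 ≤ m) :
    P.real {ω | m < net.fade Q T i ω} = p.fadeCCDF Q m := by
  cases Q
  · have h1 := hnet.measurable_fade .rf T i
    have := isProbabilityMeasure_expMeasure one_pos
    have h2 : P.real {ω | m < net.fade .rf T i ω} = (expMeasure 1).real (Iic m)ᶜ := by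
      rw [← hnet.fade_rf T i, map_measureReal_apply h1 measurableSet_Iic.compl]
      congr 1
      ext ω
      simp
    rw [h2, probReal_compl_eq_one_sub measurableSet_Iic, ← cdf_eq_real,
      cdf_expMeasure_eq one_pos, if_pos hm, one_mul, sub_sub_cancel]
    rfl
  · exact hnet.fade_thz T i m hm

lemma fade_pos (Q : Band) (T : Terminal) (i : ℕ) : ∀ᵐ ω ∂P, 0 < net.fade Q T i ω := by
  have h := measure_lt_fade hnet Q T i le_rfl
  rw [hp.fadeCCDF_zero] at h
  have hm : MeasurableSet {ω | 0 < net.fade Q T i ω} :=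
    measurableSet_lt measurable_const (hnet.measurable_fade Q T i)
  refine mem_ae_iff.2 ((prob_compl_eq_zero_iff hm).2 ?_)
  rwa [measureReal_def, ENNReal.toReal_eq_one_iff] at h

/-- The law of the fading has no atoms in `[0, ∞)`. -/
lemma measure_le_fade (Q : Band) (T : Terminal) (i : ℕ) {m : ℝ} (hm : 0 ≤ m) :
    P.real {ω | m ≤ net.fade Q T i ω} = p.fadeCCDF Q m := by
  refine le_antisymm ?_ ?_
  · rcases hm.eq_or_lt with rfl | hm'
    · rw [hp.fadeCCDF_zero]
      exact measureReal_le_one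
    · have hc : ContinuousAt (p.fadeCCDF Q) m :=
        (hp.continuousOn_fadeCCDF Q).continuousAt (Ici_mem_nhds hm')
      have hl : Filter.Tendsto (p.fadeCCDF Q) (nhdsWithin m (Iio m)) (nhds (p.fadeCCDF Q m)) :=
        hc.continuousWithinAt
      refine ge_of_tendsto hl ?_
      filter_upwards [Ioo_mem_nhdsLT hm'] with m' hm1
      rw [← measure_lt_fade hnet Q T i hm1.1.le]
      exact measureReal_mono fun ω hω => lt_of_lt_of_le hm1.2 hω
  · rw [← measure_lt_fade hnet Q T i hm]
    exact measureReal_mono fun ω hω => le_of_lt (show m < _ from hω)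

/-- The link from a relay at distance `r > 0` reaches the threshold with probability
`succProb`. -/
lemma measure_tau_le_snr (Q : Band) (T : Terminal) (i : ℕ) {r : ℝ} (hr : 0 < r) :
    P.real {ω | p.tau Q ≤ p.snr Q r (net.fade Q T i ω)} = p.succProb Q r := by
  simp only [hp.tau_le_snr_iff Q hr]
  rw [measure_le_fade hp hnet Q T i (hp.fadeThreshold_nonneg Q hr.le), Params.succProb_eq]

omit [IsProbabilityMeasure P] in
lemma measure_tau_lt_snr (Q : Band) (T : Terminal) (i : ℕ) {r : ℝ} (hr : 0 < r) :
    P.real {ω | p.tau Q < p.snr Q r (net.fade Q T i ω)} = p.succProb Q r := by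
  simp only [hp.tau_lt_snr_iff Q hr]
  rw [measure_lt_fade hnet Q T i (hp.fadeThreshold_nonneg Q hr.le), Params.succProb_eq]

/-- Both kinds of fading have average level `1`: their tails, integrated by the layer cake formula,
give the mean `1` of `X` and of `X ^ (α / 2)` respectively. -/
lemma avgFade_eq_one (Q : Band) (i : ℕ) : net.avgFade p P Q i = 1 := by
  have hpos := fade_pos hp hnet Q .dst i
  have hm := hnet.measurable_fade Q .dst i
  have hprob : ∀ {m : ℝ}, 0 ≤ m →
      P {ω | m < net.fade Q .dst i ω} = ENNReal.ofReal (p.fadeCCDF Q m) := fun {m} h => by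
    rw [← measure_lt_fade hnet Q .dst i h, ofReal_measureReal]
  cases Q
  · rw [avgFade, integral_eq_lintegral_of_nonneg_ae (hpos.mono fun ω h => h.le)
      hm.aestronglyMeasurable, lintegral_eq_lintegral_meas_lt P (hpos.mono fun ω h => h.le)
      hm.aemeasurable, setLIntegral_congr_fun measurableSet_Ioi fun t ht => hprob (le_of_lt ht)]
    simp only [Params.fadeCCDF]
    rw [← ofReal_integral_eq_lintegral_ofReal (integrableOn_exp_neg_Ioi 0)
      (ae_of_all _ fun _ => (Real.exp_pos _).le), integral_exp_neg_Ioi_zero]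
    simp
  · have ha : 0 < p.alpha / 2 := by linarith [hp.alpha_pos]
    have hpos' : 0 ≤ᵐ[P] fun ω => net.fade .thz .dst i ω ^ (p.alpha / 2) :=
      hpos.mono fun ω h => Real.rpow_nonneg h.le _
    have hm' : Measurable fun ω => net.fade .thz .dst i ω ^ (p.alpha / 2) := hm.pow_const _
    have key : ∀ t ∈ Ioi (0 : ℝ), P {ω | t < net.fade .thz .dst i ω ^ (p.alpha / 2)}
        = ENNReal.ofReal (upperGamma p.mu (p.mu * t) / Real.Gamma p.mu) := fun t ht => by
      have ht' : (0 : ℝ) < t := ht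
      have e : P {ω | t < net.fade .thz .dst i ω ^ (p.alpha / 2)}
          = P {ω | t ^ (p.alpha / 2)⁻¹ < net.fade .thz .dst i ω} := by
        refine measure_congr ?_
        filter_upwards [hpos] with ω hω
        exact propext (Real.rpow_inv_lt_iff_of_pos ht'.le hω.le ha).symm
      rw [e, hprob (Real.rpow_nonneg ht'.le _)]
      simp only [Params.fadeCCDF]
      rw [Real.rpow_inv_rpow ht'.le ha.ne']
    rw [avgFade, integral_eq_lintegral_of_nonneg_ae hpos' hm'.aestronglyMeasurable,
      lintegral_eq_lintegral_meas_lt P hpos' hm'.aemeasurable,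
      setLIntegral_congr_fun measurableSet_Ioi key, lintegral_upperGamma hp.mu_pos]
    simp

end Network.IsModel

/-! ### The distance of the nearest admissible relay -/

lemma comap_subfamily_le {Ω ι S : Type*} {X : ι → Ω → ℝ} (a : S → ι) :
    MeasurableSpace.comap (fun ω i => X (a i) ω) MeasurableSpace.pi
      ≤ ⨆ i ∈ range a, MeasurableSpace.comap (X i) inferInstance := by
  rw [← measurable_iff_comap_le]
  refine @measurable_pi_lambda _ _ _ (_) _ _ fun u => ?_
  rw [measurable_iff_comap_le]
  exact le_iSup₂_of_le (a u) (mem_range_self u) le_rfl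

/-- Subfamilies of an independent family with disjoint index sets are independent. -/
lemma indepFun_of_disjoint_index {Ω ι S T : Type*} [MeasurableSpace Ω] {P : Measure Ω}
    {X : ι → Ω → ℝ} (hX : ∀ i, Measurable (X i)) (h : iIndepFun X P) {a : S → ι} {b : T → ι}
    (hab : ∀ i j, a i ≠ b j) :
    IndepFun (fun ω i => X (a i) ω) (fun ω j => X (b j) ω) P := by
  have h1 := indep_iSup_of_disjoint (fun i => (hX i).comap_le) h.iIndep
    (S := range a) (T := range b) (by
      rw [Set.disjoint_iff_forall_ne]
      rintro _ ⟨i, rfl⟩ _ ⟨j, rfl⟩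
      exact hab i j)
  exact indep_of_indep_of_le h1 (comap_subfamily_le a) (comap_subfamily_le b)

/-- The number and the positions of the relays of one band. -/
abbrev Config : Type := ℕ × (ℕ → Plane)

/-- The configurations and source fadings of one band for which the `i`-th relay is admissible. -/
def admissibleSet (p : Params) (Q : Band) (i : ℕ) : Set (Config × (ℕ → ℝ)) :=
  {z | i < z.1.1 ∧ p.tau Q ≤ p.snr Q (dist (z.1.2 i) p.srcPos) (z.2 i)}

/-- The distance between the destination and the nearest admissible `Q` relay, as a function of
the configuration and of the source fadings; it is `∞` if there is no admissible relay. -/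
def nearestDist (p : Params) (Q : Band) (z : Config × (ℕ → ℝ)) : ℝ≥0∞ :=
  ⨅ (i : ℕ) (_ : z ∈ admissibleSet p Q i), ENNReal.ofReal (dist (z.1.2 i) 0)

lemma isFiniteMeasure_intensity (p : Params) (Q : Band) :
    IsFiniteMeasure (ENNReal.ofReal (p.lam Q) •
      volume.restrict (Metric.closedBall (0 : Plane) p.RC)) := by
  have : IsFiniteMeasure (volume.restrict (Metric.closedBall (0 : Plane) p.RC)) :=
    ⟨by
      rw [Measure.restrict_apply_univ]
      exact measure_closedBall_lt_top⟩
  exact Measure.smul_finite _ ENNReal.ofReal_ne_top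

section Deterministic

variable {p : Params} {Q : Band} {z : Config × (ℕ → ℝ)}

lemma nearestDist_le {i : ℕ} (h : z ∈ admissibleSet p Q i) :
    nearestDist p Q z ≤ ENNReal.ofReal (dist (z.1.2 i) 0) :=
  iInf₂_le i h

/-- A finite infimum is attained, since a configuration has finitely many relays. -/
lemma exists_eq_nearestDist (h : nearestDist p Q z ≠ ∞) :
    ∃ i, z ∈ admissibleSet p Q i ∧ nearestDist p Q z = ENNReal.ofReal (dist (z.1.2 i) 0) := by
  classical
  set s := (Finset.range z.1.1).filter fun i => z ∈ admissibleSet p Q i with hs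
  have hmem : ∀ i, i ∈ s ↔ z ∈ admissibleSet p Q i := fun i => by
    rw [hs, Finset.mem_filter, Finset.mem_range]
    exact ⟨fun hh => hh.2, fun hh => ⟨hh.1, hh⟩⟩
  have hne : s.Nonempty := by
    by_contra hh
    refine h (iInf₂_eq_top.2 fun i hi => ?_)
    exact absurd ⟨i, (hmem i).2 hi⟩ hh
  obtain ⟨i, hi, hmin⟩ := s.exists_min_image (fun i => dist (z.1.2 i) 0) hne
  refine ⟨i, (hmem i).1 hi, le_antisymm (nearestDist_le ((hmem i).1 hi)) ?_⟩
  exact le_iInf₂ fun j hj => ENNReal.ofReal_le_ofReal (hmin j ((hmem j).2 hj))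

lemma nearestDist_le_iff {r : ℝ} (hr : 0 ≤ r) : nearestDist p Q z ≤ ENNReal.ofReal r ↔
    ∃ i, z ∈ admissibleSet p Q i ∧ dist (z.1.2 i) 0 ≤ r := by
  constructor
  · intro h
    obtain ⟨i, hi, he⟩ := exists_eq_nearestDist (ne_top_of_le_ne_top ENNReal.ofReal_ne_top h)
    exact ⟨i, hi, (ENNReal.ofReal_le_ofReal_iff hr).1 (he ▸ h)⟩
  · rintro ⟨i, hi, hle⟩
    exact (nearestDist_le hi).trans (ENNReal.ofReal_le_ofReal hle)

lemma measurable_snr : Measurable fun q : ℝ × ℝ => p.snr Q q.1 q.2 := by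
  have : Measurable (p.pathLoss Q) := by
    cases Q
    · exact (by fun_prop : Measurable fun r : ℝ => p.gam .rf * r ^ (-p.beta .rf))
    · exact (by fun_prop :
        Measurable fun r : ℝ => p.gam .thz * Real.exp (-p.beta .thz * r) / r ^ 2)
  unfold Params.snr
  fun_prop

lemma measurableSet_admissibleSet (i : ℕ) : MeasurableSet (admissibleSet p Q i) := by
  have h1 : Measurable fun z : Config × (ℕ → ℝ) => z.1.2 i := by fun_prop
  have h2 : Measurable fun z : Config × (ℕ → ℝ) => z.2 i := by fun_prop
  exact (measurableSet_lt measurable_const (measurable_fst.fst)).inter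
    (measurableSet_le measurable_const
      (measurable_snr.comp ((h1.dist measurable_const).prodMk h2)))

lemma measurable_nearestDist : Measurable (nearestDist p Q) := by
  classical
  refine Measurable.iInf fun i => ?_
  have h1 : Measurable fun z : Config × (ℕ → ℝ) => z.1.2 i := by fun_prop
  have : (fun z => ⨅ (_ : z ∈ admissibleSet p Q i), ENNReal.ofReal (dist (z.1.2 i) 0))
      = fun z => if z ∈ admissibleSet p Q i then ENNReal.ofReal (dist (z.1.2 i) 0) else ∞ := by
    funext z
    rw [iInf_eq_if]
  rw [this]
  exact Measurable.ite (measurableSet_admissibleSet i) (h1.dist measurable_const).ennreal_ofReal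
    measurable_const

end Deterministic

namespace Network

variable {Ω : Type*} (net : Network Ω)

/-- The configuration of the `Q` relays. -/
def config (Q : Band) (ω : Ω) : Config := (net.num Q ω, fun i => net.pos Q i ω)

/-- The fading of the links between the `Q` relays and the source. -/
def srcFading (Q : Band) (ω : Ω) : ℕ → ℝ := fun i => net.fade Q .src i ω

/-- The distance between the destination and the nearest admissible `Q` relay, `∞` if there is no
such relay. -/
def admDist (p : Params) (Q : Band) (ω : Ω) : ℝ≥0∞ :=
  nearestDist p Q (net.config Q ω, net.srcFading Q ω)

namespace IsModel

variable {net} [MeasurableSpace Ω] {P : Measure Ω} [IsProbabilityMeasure P] {p : Params}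
  (hp : p.Valid) (hnet : net.IsModel p P)

include hnet

omit [IsProbabilityMeasure P] in
lemma measurable_config (Q : Band) : Measurable (net.config Q) :=
  (hnet.ppp Q).measurable_num.prodMk (measurable_pi_lambda _ fun i => (hnet.ppp Q).measurable_pos i)

omit [IsProbabilityMeasure P] in
lemma measurable_srcFading (Q : Band) : Measurable (net.srcFading Q) :=
  measurable_pi_lambda _ fun i => hnet.measurable_fade Q .src i

omit [IsProbabilityMeasure P] in
lemma measurable_admDist (Q : Band) : Measurable (net.admDist p Q) :=
  measurable_nearestDist.comp ((hnet.measurable_config Q).prodMk (hnet.measurable_srcFading Q))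

/-- The two bands have independent positions and independent fading, so the distances of their
nearest admissible relays are independent. -/
lemma indepFun_admDist (Q : Band) : IndepFun (net.admDist p Q) (net.admDist p Q.other) P := by
  suffices h : IndepFun (net.admDist p .rf) (net.admDist p .thz) P by
    cases Q
    · exact h
    · exact h.symm
  have c1 := hnet.measurable_config .rf
  have c2 := hnet.measurable_config .thz
  have f1 := hnet.measurable_srcFading .rf
  have f2 := hnet.measurable_srcFading .thz
  have hc : IndepFun (net.config .rf) (net.config .thz) P := hnet.indep_pos
  have hf : IndepFun (net.srcFading .rf) (net.srcFading .thz) P :=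
    indepFun_of_disjoint_index (X := fun k : Band × Terminal × ℕ => net.fade k.1 k.2.1 k.2.2)
      (fun k => hnet.measurable_fade k.1 k.2.1 k.2.2) hnet.indep_fade
      (a := fun i : ℕ => (Band.rf, Terminal.src, i)) (b := fun i : ℕ => (Band.thz, Terminal.src, i))
      (by simp)
  have hcf : IndepFun (fun ω => (net.config .rf ω, net.config .thz ω))
      (fun ω => (net.srcFading .rf ω, net.srcFading .thz ω)) P :=
    hnet.indep_pos_fade.comp
      (φ := fun c : Band → Config => (c .rf, c .thz))
      (ψ := fun f : Band → Terminal → ℕ → ℝ => (fun i => f .rf .src i, fun i => f .thz .src i))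
      (by fun_prop) (by fun_prop)
  have h1 := indepFun_prodMk_of_indepFun_prodMk (c1.prodMk c2) f1 f2 hcf hf
  have h2 : IndepFun (fun ω => (net.srcFading .rf ω, net.config .rf ω)) (net.config .thz) P :=
    indepFun_prodMk_of_indepFun_prodMk f1 c1 c2 (hcf.comp measurable_id measurable_fst).symm hc
  have h3 : IndepFun (net.srcFading .thz) (fun ω => (net.config .thz ω,
      (net.srcFading .rf ω, net.config .rf ω))) P :=
    h1.symm.comp (φ := id) (ψ := fun q : (Config × Config) × (ℕ → ℝ) => (q.1.2, (q.2, q.1.1)))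
      measurable_id (by fun_prop)
  have h4 := indepFun_prodMk_of_indepFun_prodMk f2 c2 (f1.prodMk c1) h3 h2.symm
  exact h4.symm.comp (measurable_nearestDist.comp measurable_swap)
    (measurable_nearestDist.comp measurable_swap)

include hp

/-- The probability that no admissible `Q` relay lies in the disc of radius `r`. Given the
positions, the relays are admissible independently of each other, so this is a value of the
generating functional of the Poisson process. -/
lemma measure_lt_admDist (Q : Band) {r : ℝ} (hr : 0 ≤ r) :
    P {ω | ENNReal.ofReal r < net.admDist p Q ω}
      = ENNReal.ofReal (p.distCCDF Q (min r p.RC)) := by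
  classical
  -- A relay at the source has SNR `0`, since the path loss takes the value `0` there.
  let a : Plane → ℝ := fun x => if x = p.srcPos then (if p.tau Q ≤ 0 then 1 else 0)
    else p.succProb Q (dist x p.srcPos)
  have ha : ∀ x, a x ∈ Icc (0 : ℝ) 1 := fun x => by
    simp only [a]
    split_ifs
    · simp
    · simp
    · exact hp.succProb_mem_Icc Q dist_nonneg
  have ham : Measurable a :=
    Measurable.ite (measurableSet_singleton _) measurable_const
      (hp.continuous_succProb_comp Q (continuous_id.dist continuous_const)
        fun _ => dist_nonneg).measurable
  have haP : ∀ i x, P {ω | p.tau Q ≤ p.snr Q (dist x p.srcPos) (net.fade Q .src i ω)}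
      = ENNReal.ofReal (a x) := fun i x => by
    by_cases hx : x = p.srcPos
    · have h0 : ∀ f, p.snr Q (dist x p.srcPos) f = 0 := fun f => by
        have := (hp.beta_pos .rf).ne'
        cases Q <;> simp [Params.snr, Params.pathLoss, hx, this]
      simp only [h0, a, if_pos hx]
      split_ifs with h <;> simp [h]
    · simp only [a, if_neg hx]
      rw [← measure_tau_le_snr hp hnet Q .src i (dist_pos.2 hx), ofReal_measureReal]
  let g : Plane → ℝ := fun x => 1 - (Metric.closedBall (0 : Plane) r).indicator a x
  have hind : ∀ x, (Metric.closedBall (0 : Plane) r).indicator a x ∈ Icc (0 : ℝ) 1 := fun x => by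
    by_cases h : x ∈ Metric.closedBall (0 : Plane) r
    · rw [indicator_of_mem h]
      exact ha x
    · rw [indicator_of_notMem h]
      simp
  have hgm : Measurable g :=
    measurable_const.sub (ham.indicator Metric.isClosed_closedBall.measurableSet)
  have hg0 : ∀ x, 0 ≤ g x := fun x => sub_nonneg.2 (hind x).2
  have hg1 : ∀ x, |g x| ≤ 1 := fun x => by
    rw [abs_of_nonneg (hg0 x)]
    exact sub_le_self _ (hind x).1
  -- Given the positions, the fading variables are independent.
  have hinner : ∀ c : Config, P {ω | ENNReal.ofReal r < nearestDist p Q (c, net.srcFading Q ω)}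
      = ENNReal.ofReal (∏ i ∈ Finset.range c.1, g (c.2 i)) := fun c => by
    have hF : iIndepFun (fun i => net.fade Q .src i) P :=
      hnet.indep_fade.precomp (g := fun i : ℕ => (Q, Terminal.src, i))
        fun i j hij => by simpa using hij
    let B : ℕ → Set ℝ := fun i =>
      {f | p.tau Q ≤ p.snr Q (dist (c.2 i) p.srcPos) f ∧ dist (c.2 i) 0 ≤ r}ᶜ
    have hB : ∀ i, MeasurableSet (B i) := fun i =>
      ((measurableSet_le measurable_const (measurable_snr.comp
        (measurable_const.prodMk measurable_id))).inter (MeasurableSet.const _)).compl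
    have h1 : {ω | ENNReal.ofReal r < nearestDist p Q (c, net.srcFading Q ω)}
        = ⋂ i ∈ Finset.range c.1, net.fade Q .src i ⁻¹' B i := by
      ext ω
      rw [mem_ofPred_eq, ← not_le, nearestDist_le_iff hr]
      simp only [mem_iInter, Finset.mem_range, not_exists]
      refine forall_congr' fun i => ?_
      constructor
      · intro h hi hh
        exact h ⟨⟨hi, hh.1⟩, hh.2⟩
      · rintro h ⟨⟨hi, h1⟩, h2⟩
        exact h hi ⟨h1, h2⟩
    rw [h1, hF.measure_inter_preimage_eq_mul (Finset.range c.1) (fun i _ => hB i),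
      ENNReal.ofReal_prod_of_nonneg fun i _ => hg0 _]
    refine Finset.prod_congr rfl fun i _ => ?_
    rw [show net.fade Q .src i ⁻¹' B i = (net.fade Q .src i ⁻¹' (B i)ᶜ)ᶜ by simp,
      prob_compl_eq_one_sub (hnet.measurable_fade Q .src i (hB i).compl)]
    simp only [g]
    rw [ENNReal.ofReal_sub _ (hind _).1, ENNReal.ofReal_one]
    congr 1
    by_cases h : dist (c.2 i) 0 ≤ r
    · rw [indicator_of_mem (Metric.mem_closedBall.2 h), ← haP i]
      congr 1
      ext ω
      simp [B, h, -dist_zero_right]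
    · rw [indicator_of_notMem (fun hh => h (Metric.mem_closedBall.1 hh))]
      simp [B, h, -dist_zero_right]
  have hS : MeasurableSet {z : Config × (ℕ → ℝ) | ENNReal.ofReal r < nearestDist p Q z} :=
    measurableSet_lt measurable_const measurable_nearestDist
  have hcf : IndepFun (net.config Q) (net.srcFading Q) P :=
    hnet.indep_pos_fade.comp (φ := fun c : Band → Config => c Q)
      (ψ := fun f : Band → Terminal → ℕ → ℝ => fun i => f Q .src i) (by fun_prop) (by fun_prop)
  have h1 := measure_prodMk_mem_of_indepFun (hnet.measurable_config Q)
    (hnet.measurable_srcFading Q) hcf hS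
  have h2 : P {ω | ENNReal.ofReal r < net.admDist p Q ω}
      = ∫⁻ ω, ENNReal.ofReal (∏ i ∈ Finset.range (net.num Q ω), g (net.pos Q i ω)) ∂P :=
    h1.trans (lintegral_congr fun ω => hinner (net.config Q ω))
  have hΛ := isFiniteMeasure_intensity p Q
  have hpm := measurable_prod_range (hnet.ppp Q).measurable_num (hnet.ppp Q).measurable_pos hgm
  have hp0 : ∀ ω, 0 ≤ ∏ i ∈ Finset.range (net.num Q ω), g (net.pos Q i ω) :=
    fun ω => Finset.prod_nonneg fun i _ => hg0 _
  have hp1 : ∀ ω, ∏ i ∈ Finset.range (net.num Q ω), g (net.pos Q i ω) ≤ 1 :=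
    fun ω => Finset.prod_le_one (fun i _ => hg0 _) fun i _ => (le_abs_self _).trans (hg1 _)
  have hint : Integrable (fun ω => ∏ i ∈ Finset.range (net.num Q ω), g (net.pos Q i ω)) P :=
    Integrable.of_bound hpm.aestronglyMeasurable 1 (ae_of_all _ fun ω => by
      rw [Real.norm_eq_abs, abs_of_nonneg (hp0 ω)]
      exact hp1 ω)
  rw [h2, ← ofReal_integral_eq_lintegral_ofReal hint (ae_of_all _ hp0),
    integral_prod_poisson (hnet.ppp Q) hgm hg1, Params.distCCDF_eq,
    ← hp.integral_succProb_closedBall Q (le_min hr hp.RC_pos.le)]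
  congr 3
  simp only [g, sub_sub_cancel]
  rw [integral_smul_measure, ENNReal.toReal_ofReal (hp.lam_nonneg Q), smul_eq_mul,
    setIntegral_indicator Metric.isClosed_closedBall.measurableSet]
  congr 1
  have hball : Metric.closedBall (0 : Plane) p.RC ∩ Metric.closedBall 0 r
      = Metric.closedBall 0 (min r p.RC) := by
    ext x
    simp [and_comm]
  rw [hball]
  refine integral_congr_ae (ae_restrict_of_ae ?_)
  filter_upwards [compl_mem_ae_iff.2 (measure_singleton p.srcPos)] with x hx
  exact if_neg hx

lemma measure_admDist_le (Q : Band) {r : ℝ} (hr : 0 ≤ r) :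
    P {ω | net.admDist p Q ω ≤ ENNReal.ofReal r}
      = ENNReal.ofReal (∫ ρ in (0 : ℝ)..r, p.distPDF Q ρ) := by
  have h : {ω | net.admDist p Q ω ≤ ENNReal.ofReal r}
      = {ω | ENNReal.ofReal r < net.admDist p Q ω}ᶜ := by
    ext ω
    simp
  rw [h, prob_compl_eq_one_sub (measurableSet_lt measurable_const (hnet.measurable_admDist Q)),
    measure_lt_admDist hp hnet Q hr, hp.integral_distPDF Q hr,
    ENNReal.ofReal_sub 1 (show 0 ≤ p.distCCDF Q (min r p.RC) from (Real.exp_pos _).le),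
    ENNReal.ofReal_one]

end IsModel
end Network

/-! ### Equidistant relays -/

section Ties

variable {Ω E : Type*} [MeasurableSpace Ω] [MeasurableSpace E] {P : Measure Ω}
  [IsProbabilityMeasure P] {N : Ω → ℕ} {X : ℕ → Ω → E} {Λ : Measure E}

omit [IsProbabilityMeasure P] in
lemma measure_two_le_countIn [IsFiniteMeasure Λ] (h : IsPoissonPointProcess P N X Λ) {A : Set E}
    (hA : MeasurableSet A) :
    P {ω | 2 ≤ countIn A (N ω) (fun i => X i ω)} ≤ Λ A ^ 2 := by
  have hm := measurable_countIn h.measurable_num h.measurable_pos hA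
  set l := (Λ A).toNNReal with hl
  have h1 : P {ω | 2 ≤ countIn A (N ω) (fun i => X i ω)} = poissonMeasure l {k | 2 ≤ k} := by
    rw [← h.poisson A hA, Measure.map_apply hm MeasurableSet.of_discrete]
    rfl
  have h2 : {k : ℕ | 2 ≤ k} = ({0, 1} : Set ℕ)ᶜ := by
    ext k
    simp only [mem_ofPred_eq, mem_compl_iff, mem_insert_iff, mem_singleton_iff]
    omega
  have h3 : (poissonMeasure l).real {0, 1} = Real.exp (-l) * (1 + l) := by
    rw [show ({0, 1} : Set ℕ) = {0} ∪ {1} from rfl,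
      measureReal_union (by simp : Disjoint ({0} : Set ℕ) {1}) MeasurableSet.of_discrete,
      poissonMeasure_real_singleton,
      poissonMeasure_real_singleton]
    simp
    ring
  have h4 : (poissonMeasure l).real {k | 2 ≤ k} ≤ (l : ℝ) ^ 2 := by
    rw [h2, probReal_compl_eq_one_sub MeasurableSet.of_discrete, h3]
    have := mul_le_mul_of_nonneg_right (Real.one_sub_le_exp_neg l)
      (by positivity : (0 : ℝ) ≤ 1 + l)
    nlinarith
  rw [h1, ← ENNReal.coe_toNNReal (measure_ne_top Λ A), ← hl, ← ofReal_measureReal,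
    ← ENNReal.coe_pow, ← ENNReal.ofReal_coe_nnreal]
  exact ENNReal.ofReal_le_ofReal (by simpa using h4)

end Ties

lemma volume_annulus (a b : ℝ) (ha : 0 ≤ a) (hab : a ≤ b) :
    volume (Metric.closedBall (0 : Plane) b \ Metric.closedBall 0 a)
      = ENNReal.ofReal (Real.pi * (b ^ 2 - a ^ 2)) := by
  rw [measure_sdiff (Metric.closedBall_subset_closedBall hab)
    Metric.isClosed_closedBall.measurableSet.nullMeasurableSet measure_closedBall_lt_top.ne,
    EuclideanSpace.volume_closedBall_fin_two, EuclideanSpace.volume_closedBall_fin_two,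
    ← ENNReal.ofReal_pow ha, ← ENNReal.ofReal_pow (ha.trans hab),
    ← ENNReal.ofReal_mul (by positivity), ← ENNReal.ofReal_mul (by positivity),
    ← ENNReal.ofReal_sub _ (by positivity)]
  congr 1
  ring

variable {Ω : Type*} [MeasurableSpace Ω] {P : Measure Ω} [IsProbabilityMeasure P] {p : Params}
  {net : Network Ω}

omit [IsProbabilityMeasure P] in
/-- Almost surely, no two relays of a band have the same positive distance from the destination.
The disc is cut into annuli of width `1 / m`, whose intensities are of order `1 / m`; two relays
in the same annulus have a probability of the order of the square, and the sum of these squares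
tends to zero. -/
lemma Network.IsModel.ae_dist_injective (hp : p.Valid) (hnet : net.IsModel p P) (Q : Band) :
    ∀ᵐ ω ∂P, ∀ i j, i < net.num Q ω → j < net.num Q ω → 0 < dist (net.pos Q i ω) 0 →
      dist (net.pos Q i ω) 0 = dist (net.pos Q j ω) 0 → i = j := by
  set Λ := ENNReal.ofReal (p.lam Q) • volume.restrict (Metric.closedBall (0 : Plane) p.RC) with hΛ
  have hΛfin : IsFiniteMeasure Λ := isFiniteMeasure_intensity p Q
  have hppp : IsPoissonPointProcess P (net.num Q) (net.pos Q) Λ := hnet.ppp Q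
  set C := p.lam Q * (Real.pi * (2 * p.RC + 1)) with hC
  have hC0 : 0 ≤ C := by
    have := hp.lam_nonneg Q
    have := hp.RC_pos
    positivity
  set bad := {ω | ∃ i j, i < net.num Q ω ∧ j < net.num Q ω ∧ 0 < dist (net.pos Q i ω) 0 ∧
      dist (net.pos Q i ω) 0 = dist (net.pos Q j ω) 0 ∧ i ≠ j} with hbad
  suffices h : ∀ n : ℕ, P bad ≤ ENNReal.ofReal (C / (n + 1)) * Λ univ by
    have hlim : Filter.Tendsto (fun n : ℕ => ENNReal.ofReal (C / (n + 1)) * Λ univ) Filter.atTop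
        (nhds 0) := by
      have h1 : Filter.Tendsto (fun n : ℕ => C / ((n : ℝ) + 1)) Filter.atTop (nhds 0) := by
        simpa [div_eq_mul_inv] using (tendsto_one_div_add_atTop_nhds_zero_nat (𝕜 := ℝ)).const_mul C
      have h2 := ENNReal.Tendsto.mul_const (ENNReal.tendsto_ofReal h1)
        (Or.inr (measure_ne_top Λ univ))
      simpa using h2
    have h0 : P bad = 0 := le_antisymm (ge_of_tendsto' hlim h) bot_le
    filter_upwards [compl_mem_ae_iff.2 h0] with ω hω i j hi hj hpos heq
    by_contra hij
    exact hω ⟨i, j, hi, hj, hpos, heq, hij⟩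
  intro n
  set m : ℝ := n + 1 with hm
  have hm1 : 1 ≤ m := by
    rw [hm]
    linarith [(Nat.cast_nonneg n : (0 : ℝ) ≤ n)]
  have hm0 : 0 < m := by linarith
  let A : ℕ → Set Plane := fun k =>
    Metric.closedBall 0 ((k + 1 : ℝ) / m) \ Metric.closedBall 0 ((k : ℝ) / m)
  have hA : ∀ k, MeasurableSet (A k) := fun k =>
    Metric.isClosed_closedBall.measurableSet.diff Metric.isClosed_closedBall.measurableSet
  have hmemA : ∀ k x, x ∈ A k ↔ dist x 0 * m ≤ k + 1 ∧ k < dist x 0 * m := fun k x => by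
    simp only [A, mem_sdiff, Metric.mem_closedBall, not_le, le_div_iff₀ hm0]
  have hdisj : Pairwise fun j k => Disjoint (A j) (A k) := by
    intro j k hjk
    rw [Set.disjoint_left]
    intro x hj hk
    rw [hmemA] at hj hk
    have h1 : (j : ℝ) < (k + 1 : ℕ) := by
      push_cast
      linarith [hj.2, hk.1]
    have h2 : (k : ℝ) < (j + 1 : ℕ) := by
      push_cast
      linarith [hj.1, hk.2]
    have h3 := Nat.cast_lt.1 h1
    have h4 := Nat.cast_lt.1 h2
    omega
  have hΛA : ∀ k, Λ (A k) ≤ ENNReal.ofReal (C / m) := fun k => by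
    rw [hΛ, Measure.smul_apply, Measure.restrict_apply (hA k), smul_eq_mul]
    by_cases hk : (k : ℝ) ≤ p.RC * m
    · calc _ ≤ ENNReal.ofReal (p.lam Q) * volume (A k) := by
            gcongr
            exact inter_subset_left
        _ = ENNReal.ofReal (p.lam Q * (Real.pi * (((k + 1 : ℝ) / m) ^ 2 - ((k : ℝ) / m) ^ 2))) := by
            rw [ENNReal.ofReal_mul (hp.lam_nonneg Q)]
            congr 1
            refine volume_annulus _ _ (by positivity) ?_
            gcongr
            linarith
        _ ≤ ENNReal.ofReal (C / m) := by
            refine ENNReal.ofReal_le_ofReal ?_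
            rw [hC, mul_div_assoc, mul_div_assoc]
            refine mul_le_mul_of_nonneg_left (mul_le_mul_of_nonneg_left ?_ Real.pi_pos.le)
              (hp.lam_nonneg Q)
            rw [div_pow, div_pow, ← sub_div, div_le_div_iff₀ (by positivity) hm0]
            nlinarith [mul_le_mul_of_nonneg_right hk hm0.le]
    · have : A k ∩ Metric.closedBall 0 p.RC = ∅ := by
        refine eq_empty_of_forall_notMem fun x hx => hk ?_
        have h1 := ((hmemA k x).1 hx.1).2
        have h2 := mul_le_mul_of_nonneg_right (Metric.mem_closedBall.1 hx.2) hm0.le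
        linarith
      rw [this]
      simp
  have hcover : bad ⊆ ⋃ k, {ω | 2 ≤ countIn (A k) (net.num Q ω) (fun i => net.pos Q i ω)} := by
    classical
    rintro ω ⟨i, j, hi, hj, hpos, heq, hij⟩
    have hpos' := mul_pos hpos hm0
    have hc := Nat.ceil_pos.2 hpos'
    have h1 : ∀ l, dist (net.pos Q l ω) 0 = dist (net.pos Q i ω) 0 →
        net.pos Q l ω ∈ A (⌈dist (net.pos Q i ω) 0 * m⌉₊ - 1) := fun l hl => by
      rw [hmemA, hl, Nat.cast_sub hc, Nat.cast_one, sub_add_cancel]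
      exact ⟨Nat.le_ceil _, by linarith [Nat.ceil_lt_add_one hpos'.le]⟩
    refine mem_iUnion.2 ⟨⌈dist (net.pos Q i ω) 0 * m⌉₊ - 1, ?_⟩
    rw [mem_ofPred_eq, countIn_eq_card]
    refine (Finset.card_pair hij).symm.le.trans (Finset.card_le_card fun l hl => ?_)
    rw [Finset.mem_filter, Finset.mem_range]
    rcases Finset.mem_insert.1 hl with rfl | hl
    · exact ⟨hi, h1 _ rfl⟩
    · rw [Finset.mem_singleton.1 hl]
      exact ⟨hj, h1 _ heq.symm⟩
  calc P bad ≤ ∑' k, P {ω | 2 ≤ countIn (A k) (net.num Q ω) (fun i => net.pos Q i ω)} :=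
        (measure_mono hcover).trans (measure_iUnion_le _)
    _ ≤ ∑' k, ENNReal.ofReal (C / m) * Λ (A k) := by
        refine ENNReal.tsum_le_tsum fun k => (measure_two_le_countIn hppp (hA k)).trans ?_
        rw [pow_two]
        gcongr
        exact hΛA k
    _ = ENNReal.ofReal (C / m) * Λ (⋃ k, A k) := by
        rw [ENNReal.tsum_mul_left, measure_iUnion hdisj hA]
    _ ≤ ENNReal.ofReal (C / m) * Λ univ := by
        gcongr
        exact subset_univ _

/-! ### The selected relay -/

/-- The pairs of distances, of the nearest admissible `Q` relay and of the nearest admissible relay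
of the other band, for which a `Q` relay is selected. -/
def selectionSet (p : Params) (Q : Band) : Set (ℝ≥0∞ × ℝ≥0∞) :=
  {z | z.1 ≠ ∞ ∧ (z.2 = ∞ ∨ p.meanRate Q.other z.2.toReal ≤ p.meanRate Q z.1.toReal)}

lemma Params.measurable_meanRate (p : Params) (Q : Band) : Measurable (p.meanRate Q) := by
  have h : Measurable (p.meanSNR Q) :=
    (measurable_snr (p := p) (Q := Q)).comp (measurable_id.prodMk measurable_const)
  have h2 : Measurable fun r =>
      p.bandwidth Q / 2 * (Real.log (1 + p.meanSNR Q r) / Real.log 2) := by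
    fun_prop
  exact h2

lemma measurableSet_selectionSet (p : Params) (Q : Band) : MeasurableSet (selectionSet p Q) := by
  have h1 : MeasurableSet {z : ℝ≥0∞ × ℝ≥0∞ | z.1 ≠ ∞} :=
    (measurable_fst (measurableSet_singleton ∞)).compl
  have h2 : MeasurableSet {z : ℝ≥0∞ × ℝ≥0∞ | z.2 = ∞} := measurable_snd (measurableSet_singleton ∞)
  exact h1.inter (h2.union (measurableSet_le
    ((p.measurable_meanRate Q.other).comp measurable_snd.ennreal_toReal)
    ((p.measurable_meanRate Q).comp measurable_fst.ennreal_toReal)))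

namespace Network

variable {Ω : Type*} {net : Network Ω}

/-- A `Q` relay is selected, in terms of the distances of the nearest admissible relays. -/
def bandSelected (net : Network Ω) (p : Params) (Q : Band) : Set Ω :=
  {ω | (net.admDist p Q ω, net.admDist p Q.other ω) ∈ selectionSet p Q}

/-- The `i`-th relay of band `Q` is selected, in terms of the distances of the nearest admissible
relays. -/
def relaySelected (net : Network Ω) (p : Params) (Q : Band) (i : ℕ) : Set Ω :=
  {ω | net.Admissible p Q i ω ∧ net.admDist p Q ω = ENNReal.ofReal (dist (net.pos Q i ω) 0)}
    ∩ net.bandSelected p Q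

namespace IsModel

variable [MeasurableSpace Ω] {P : Measure Ω} [IsProbabilityMeasure P] {p : Params}
  (hp : p.Valid) (hnet : net.IsModel p P)

include hnet

omit [IsProbabilityMeasure P] in
lemma measurableSet_bandSelected (Q : Band) : MeasurableSet (net.bandSelected p Q) :=
  ((hnet.measurable_admDist Q).prodMk (hnet.measurable_admDist Q.other))
    (measurableSet_selectionSet p Q)

include hp

/-- The law of the distance of the nearest admissible relay, where it is finite. -/
lemma map_admDist (Q : Band) :
    (P.restrict {ω | net.admDist p Q ω ≠ ∞}).map (fun ω => (net.admDist p Q ω).toReal)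
      = volume.withDensity fun ρ => ENNReal.ofReal (p.distPDF Q ρ) := by
  have hm := hnet.measurable_admDist (p := p) Q
  have hfin : IsFiniteMeasure (volume.withDensity fun ρ => ENNReal.ofReal (p.distPDF Q ρ)) :=
    isFiniteMeasure_withDensity_ofReal (hp.integrable_distPDF Q).2
  refine Measure.ext_of_Iic _ _ fun a => ?_
  rw [Measure.map_apply hm.ennreal_toReal measurableSet_Iic,
    Measure.restrict_apply (hm.ennreal_toReal measurableSet_Iic),
    withDensity_apply _ measurableSet_Iic,
    ← ofReal_integral_eq_lintegral_ofReal (hp.integrable_distPDF Q).integrableOn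
      (ae_of_all _ fun ρ => hp.distPDF_nonneg Q ρ)]
  rcases le_or_gt 0 a with ha | ha
  · have h1 : (fun ω => (net.admDist p Q ω).toReal) ⁻¹' Iic a ∩ {ω | net.admDist p Q ω ≠ ∞}
        = {ω | net.admDist p Q ω ≤ ENNReal.ofReal a} := by
      ext ω
      simp only [mem_inter_iff, mem_preimage, mem_Iic, mem_ofPred_eq]
      constructor
      · rintro ⟨h1, h2⟩
        exact (ENNReal.le_ofReal_iff_toReal_le h2 ha).2 h1
      · intro h
        have h2 := ne_top_of_le_ne_top ENNReal.ofReal_ne_top h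
        exact ⟨(ENNReal.le_ofReal_iff_toReal_le h2 ha).1 h, h2⟩
    rw [h1, measure_admDist_le hp hnet Q ha, intervalIntegral.integral_of_le ha]
    congr 1
    refine (setIntegral_eq_of_subset_of_forall_sdiff_eq_zero measurableSet_Iic
      Ioc_subset_Iic_self fun ρ hρ => Params.distPDF_of_nonpos Q ?_).symm
    by_contra h
    exact hρ.2 ⟨not_le.1 h, hρ.1⟩
  · have h1 : (fun ω => (net.admDist p Q ω).toReal) ⁻¹' Iic a = ∅ :=
      eq_empty_of_forall_notMem fun ω hω =>
        absurd (ENNReal.toReal_nonneg.trans hω) (not_le.2 ha)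
    have h2 : ∫ ρ in Iic a, p.distPDF Q ρ = 0 :=
      setIntegral_eq_zero_of_forall_eq_zero fun ρ hρ =>
        Params.distPDF_of_nonpos Q ((mem_Iic.1 hρ).trans ha.le)
    rw [h1, h2]
    simp

/-- The distance of the nearest admissible relay has no atom except `∞`. -/
lemma measure_admDist_eq (Q : Band) {d : ℝ≥0∞} (hd : d ≠ ∞) :
    P {ω | net.admDist p Q ω = d} = 0 := by
  have hm := hnet.measurable_admDist (p := p) Q
  have h1 := DFunLike.congr_fun (map_admDist hp hnet Q) {d.toReal}
  rw [withDensity_absolutelyContinuous _ _ (measure_singleton d.toReal),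
    Measure.map_apply hm.ennreal_toReal (measurableSet_singleton _),
    Measure.restrict_apply (hm.ennreal_toReal (measurableSet_singleton _))] at h1
  refine measure_mono_null (fun ω hω => ?_) h1
  have hω' : net.admDist p Q ω = d := hω
  exact ⟨by simp [hω'], by simpa [hω'] using hd⟩

/-- Almost surely no admissible relay sits at the destination, where the path loss has the junk
value `0`. -/
lemma ae_admDist_ne_zero : ∀ᵐ ω ∂P, ∀ Q, net.admDist p Q ω ≠ 0 := by
  have h := fun Q => compl_mem_ae_iff.2 (measure_admDist_eq hp hnet Q ENNReal.zero_ne_top)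
  filter_upwards [h .rf, h .thz] with ω h1 h2 Q
  cases Q
  · exact h1
  · exact h2

/-- A `Q` relay at distance `ρ` from the destination, nearest among the admissible ones of its
band, is selected with probability `assocProb`. -/
lemma measure_selectionSet (Q : Band) {ρ : ℝ} (hρ : 0 < ρ) :
    P {ω | (ENNReal.ofReal ρ, net.admDist p Q.other ω) ∈ selectionSet p Q}
      = ENNReal.ofReal (p.assocProb Q ρ) := by
  have hs := (hp.meanSNR_switchDist Q hρ).1
  have h1 : P {ω | (ENNReal.ofReal ρ, net.admDist p Q.other ω) ∈ selectionSet p Q}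
      = P {ω | ENNReal.ofReal (p.switchDist Q ρ) < net.admDist p Q.other ω} := by
    refine measure_congr ?_
    filter_upwards [compl_mem_ae_iff.2 (measure_admDist_eq hp hnet Q.other
      (d := ENNReal.ofReal (p.switchDist Q ρ)) ENNReal.ofReal_ne_top),
      ae_admDist_ne_zero hp hnet] with ω hω h0
    refine propext ?_
    change (_ ∧ _) ↔ ENNReal.ofReal (p.switchDist Q ρ) < net.admDist p Q.other ω
    simp only [ENNReal.toReal_ofReal hρ.le]
    rcases eq_or_ne (net.admDist p Q.other ω) ∞ with htop | htop
    · simp [htop]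
    · rw [hp.meanRate_le_iff Q hρ (ENNReal.toReal_pos (h0 _) htop),
        ← ENNReal.ofReal_le_iff_le_toReal htop]
      simp only [htop, false_or, ne_eq, ENNReal.ofReal_ne_top, not_false_eq_true, true_and]
      exact ⟨fun h => lt_of_le_of_ne h fun he => hω he.symm, le_of_lt⟩
  rw [h1, measure_lt_admDist hp hnet Q.other hs.le, hp.assocProb_eq Q hρ]

omit hp in
lemma measurable_measure_selectionSet (Q : Band) : Measurable fun ρ : ℝ =>
    P {ω | (ENNReal.ofReal ρ, net.admDist p Q.other ω) ∈ selectionSet p Q} := by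
  have hm := hnet.measurable_admDist (p := p) Q.other
  have h := (measurable_measure_prodMk_left (ν := P.map (net.admDist p Q.other))
    (measurableSet_selectionSet p Q)).comp ENNReal.measurable_ofReal
  have e : (fun ρ : ℝ => P {ω | (ENNReal.ofReal ρ, net.admDist p Q.other ω) ∈ selectionSet p Q})
      = (fun d => P.map (net.admDist p Q.other) (Prod.mk d ⁻¹' selectionSet p Q))
        ∘ ENNReal.ofReal := funext fun ρ =>
    (Measure.map_apply hm (measurable_prodMk_left (measurableSet_selectionSet p Q))).symm
  rw [e]
  exact h

/-- The law of the distance of the nearest admissible `Q` relay on the event that a `Q` relay is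
selected. -/
lemma lintegral_bandSelected (Q : Band) {h : ℝ → ℝ≥0∞} (hh : Measurable h) :
    ∫⁻ ω in net.bandSelected p Q, h (net.admDist p Q ω).toReal ∂P
      = ∫⁻ ρ, ENNReal.ofReal (p.distPDF Q ρ * p.assocProb Q ρ) * h ρ := by
  have hm := hnet.measurable_admDist (p := p) Q
  have hm' := hnet.measurable_admDist (p := p) Q.other
  have hS := measurableSet_selectionSet p Q
  set W : ℝ → ℝ≥0∞ := fun ρ =>
    P {ω | (ENNReal.ofReal ρ, net.admDist p Q.other ω) ∈ selectionSet p Q} with hW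
  have hWm : Measurable W := measurable_measure_selectionSet hnet Q
  have hφ : Measurable ((selectionSet p Q).indicator fun z => h z.1.toReal) :=
    (hh.comp measurable_fst.ennreal_toReal).indicator hS
  have h1 := lintegral_comp_prodMk_of_indepFun hm hm' (hnet.indepFun_admDist Q) hφ
  have h2 : ∫⁻ ω in net.bandSelected p Q, h (net.admDist p Q ω).toReal ∂P
      = ∫⁻ ω, (selectionSet p Q).indicator (fun z => h z.1.toReal)
        (net.admDist p Q ω, net.admDist p Q.other ω) ∂P := by
    rw [← lintegral_indicator (hnet.measurableSet_bandSelected Q)]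
    rfl
  have h3 : ∀ ω, ∫⁻ ω', (selectionSet p Q).indicator (fun z => h z.1.toReal)
        (net.admDist p Q ω, net.admDist p Q.other ω') ∂P
      = {ω | net.admDist p Q ω ≠ ∞}.indicator
        (fun ω => h (net.admDist p Q ω).toReal * W (net.admDist p Q ω).toReal) ω := fun ω => by
    by_cases htop : net.admDist p Q ω = ∞
    · rw [indicator_of_notMem (by simpa using htop)]
      refine (lintegral_congr fun ω' => ?_).trans lintegral_zero
      exact indicator_of_notMem (fun hh => hh.1 htop) _
    · rw [indicator_of_mem (show ω ∈ {ω | net.admDist p Q ω ≠ ∞} from htop)]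
      simp only [hW, ENNReal.ofReal_toReal htop]
      have hT : MeasurableSet {ω' | (net.admDist p Q ω, net.admDist p Q.other ω')
          ∈ selectionSet p Q} := (measurable_const.prodMk hm') hS
      rw [← lintegral_indicator_const hT]
      rfl
  have hne : MeasurableSet {ω | net.admDist p Q ω ≠ ∞} := (hm (measurableSet_singleton ∞)).compl
  rw [h2, h1, lintegral_congr h3, lintegral_indicator hne]
  have h4 := lintegral_map (μ := P.restrict {ω | net.admDist p Q ω ≠ ∞}) (hh.mul hWm)
    hm.ennreal_toReal
  have hfm : Measurable fun ρ => ENNReal.ofReal (p.distPDF Q ρ) :=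
    (hp.measurable_distPDF Q).ennreal_ofReal
  rw [map_admDist hp hnet Q, lintegral_withDensity_eq_lintegral_mul _ hfm (hh.mul hWm)] at h4
  refine h4.symm.trans (lintegral_congr fun ρ => ?_)
  simp only [Pi.mul_apply]
  rcases le_or_gt ρ 0 with hρ | hρ
  · simp [Params.distPDF_of_nonpos Q hρ]
  · rw [hW, ENNReal.ofReal_mul (hp.distPDF_nonneg Q ρ), ← measure_selectionSet hp hnet Q hρ]
    ring

lemma avgRate_eq (Q : Band) (i : ℕ) (ω : Ω) :
    net.avgRate p P Q i ω = p.meanRate Q (dist (net.pos Q i ω) 0) := by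
  rw [avgRate, avgFade_eq_one hp hnet]
  rfl

/-- The average rate decreases with the distance, so the selected relay is the nearest admissible
relay of its band. -/
lemma selected_iff {ω : Ω} (h0 : ∀ Q, net.admDist p Q ω ≠ 0) (Q : Band) (i : ℕ) :
    net.Selected p P Q i ω ↔ ω ∈ net.relaySelected p Q i := by
  have hle : ∀ {Q j}, net.Admissible p Q j ω →
      net.admDist p Q ω ≤ ENNReal.ofReal (dist (net.pos Q j ω) 0) := fun {Q j} h =>
    nearestDist_le (p := p) (Q := Q) (z := (net.config Q ω, net.srcFading Q ω)) h
  have hpos : ∀ {Q j}, net.Admissible p Q j ω → 0 < dist (net.pos Q j ω) 0 := fun {Q j} h =>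
    ENNReal.ofReal_pos.1 (lt_of_lt_of_le (pos_iff_ne_zero.2 (h0 Q)) (hle h))
  simp only [Selected, avgRate_eq hp hnet]
  constructor
  · rintro ⟨hadm, hmax⟩
    have heq : net.admDist p Q ω = ENNReal.ofReal (dist (net.pos Q i ω) 0) := by
      refine le_antisymm (hle hadm) (le_iInf₂ fun j hj => ENNReal.ofReal_le_ofReal ?_)
      exact ((hp.strictAntiOn_meanRate Q).le_iff_ge (hpos hj) (hpos hadm)).1 (hmax Q j hj)
    refine ⟨⟨hadm, heq⟩, by simp [heq], ?_⟩
    rcases eq_or_ne (net.admDist p Q.other ω) ∞ with htop | htop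
    · exact Or.inl htop
    · refine Or.inr ?_
      obtain ⟨j, hj, hj'⟩ := exists_eq_nearestDist (p := p) (Q := Q.other)
        (z := (net.config Q.other ω, net.srcFading Q.other ω)) htop
      have h1 : net.admDist p Q.other ω = ENNReal.ofReal (dist (net.pos Q.other j ω) 0) := hj'
      simp only [heq, h1, ENNReal.toReal_ofReal dist_nonneg]
      exact hmax Q.other j hj
  · rintro ⟨⟨hadm, heq⟩, -, hsel⟩
    refine ⟨hadm, fun Q' j hj => ?_⟩
    simp only [heq, ENNReal.toReal_ofReal dist_nonneg] at hsel
    have hQ : Q' = Q ∨ Q' = Q.other := by cases Q <;> cases Q' <;> simp [Band.other]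
    rcases hQ with rfl | rfl
    · refine ((hp.strictAntiOn_meanRate Q').le_iff_ge (hpos hj) (hpos hadm)).2 ?_
      have := hle hj
      rw [heq] at this
      exact (ENNReal.ofReal_le_ofReal_iff dist_nonneg).1 this
    · have htop := ne_top_of_le_ne_top ENNReal.ofReal_ne_top (hle hj)
      refine le_trans ?_ (hsel.resolve_left htop)
      refine ((hp.strictAntiOn_meanRate Q.other).le_iff_ge (hpos hj)
        (ENNReal.toReal_pos (h0 _) htop)).2 ?_
      exact (ENNReal.le_ofReal_iff_toReal_le htop dist_nonneg).1 (hle hj)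

omit hp hnet [MeasurableSpace Ω] [IsProbabilityMeasure P] in
lemma iUnion_relaySelected (Q : Band) : ⋃ i, net.relaySelected p Q i = net.bandSelected p Q := by
  refine subset_antisymm (iUnion_subset fun i => inter_subset_right) fun ω hω => ?_
  obtain ⟨i, hi, hi'⟩ := exists_eq_nearestDist (p := p) (Q := Q)
    (z := (net.config Q ω, net.srcFading Q ω)) hω.1
  exact mem_iUnion.2 ⟨i, ⟨hi, hi'⟩, hω⟩

/-- Measurability follows from `measure_selectionSet`, so none is needed for `switchDist`. -/
lemma measurable_assocProb_mul (Q : Band) :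
    Measurable fun ρ => p.distPDF Q ρ * p.assocProb Q ρ := by
  have h : (fun ρ => p.distPDF Q ρ * p.assocProb Q ρ) = fun ρ => p.distPDF Q ρ *
      (P {ω | (ENNReal.ofReal ρ, net.admDist p Q.other ω) ∈ selectionSet p Q}).toReal := by
    funext ρ
    rcases le_or_gt ρ 0 with hρ | hρ
    · simp [Params.distPDF_of_nonpos Q hρ]
    · rw [measure_selectionSet hp hnet Q hρ, ENNReal.toReal_ofReal (hp.assocProb_nonneg Q hρ)]
  rw [h]
  exact (hp.measurable_distPDF Q).mul (measurable_measure_selectionSet hnet Q).ennreal_toReal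

end IsModel
end Network

/-! ### Coverage -/

namespace Network.IsModel

variable {Ω : Type*} {net : Network Ω} [MeasurableSpace Ω] {P : Measure Ω}
  [IsProbabilityMeasure P] {p : Params} (hp : p.Valid) (hnet : net.IsModel p P)

include hnet

omit [IsProbabilityMeasure P] in
lemma measurableSet_linkSNR (Q : Band) (T : Terminal) (i : ℕ) :
    MeasurableSet {ω | p.tau Q < net.linkSNR p Q T i ω} :=
  measurableSet_lt measurable_const (measurable_snr.comp
    ((((hnet.ppp Q).measurable_pos i).dist measurable_const).prodMk
      (hnet.measurable_fade Q T i)))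

/-- All relay positions and all source fadings together are independent of each single fading at
the destination. -/
lemma indepFun_dstFading (Q : Band) (i : ℕ) :
    IndepFun (fun ω => ((fun Q' => net.config Q' ω),
      (fun k : Band × ℕ => net.fade k.1 .src k.2 ω))) (net.fade Q .dst i) P := by
  have hm := hnet.measurable_fade
  have h1 : IndepFun (fun ω (k : Band × ℕ) => net.fade k.1 .src k.2 ω) (net.fade Q .dst i) P :=
    (indepFun_of_disjoint_index (X := fun k : Band × Terminal × ℕ => net.fade k.1 k.2.1 k.2.2)
      (fun k => hm _ _ _) hnet.indep_fade (a := fun k : Band × ℕ => (k.1, Terminal.src, k.2))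
      (b := fun _ : Unit => (Q, Terminal.dst, i)) (by simp)).comp measurable_id
      (measurable_pi_apply ())
  refine indepFun_prodMk_of_indepFun_prodMk
    (measurable_pi_lambda _ fun Q' => hnet.measurable_config Q')
    (measurable_pi_lambda _ fun k => hm _ _ _) (hm _ _ _) ?_ h1
  exact hnet.indep_pos_fade.comp (φ := id)
    (ψ := fun f : Band → Terminal → ℕ → ℝ => ((fun k : Band × ℕ => f k.1 .src k.2), f Q .dst i))
    measurable_id (by fun_prop)

omit hnet [MeasurableSpace Ω] [IsProbabilityMeasure P] in
/-- The event that the `i`-th relay of band `Q` is selected depends on the positions and on the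
source fadings only. -/
lemma exists_relaySelected_eq_preimage (Q : Band) (i : ℕ) :
    ∃ S : Set ((Band → Config) × (Band × ℕ → ℝ)), MeasurableSet S ∧ net.relaySelected p Q i =
      (fun ω => ((fun Q' => net.config Q' ω),
        (fun k : Band × ℕ => net.fade k.1 .src k.2 ω))) ⁻¹' S := by
  have hz : ∀ Q', Measurable fun s : (Band → Config) × (Band × ℕ → ℝ) =>
      ((s.1 Q', fun j => s.2 (Q', j)) : Config × (ℕ → ℝ)) := fun Q' => by fun_prop
  have hd : ∀ Q', Measurable fun s : (Band → Config) × (Band × ℕ → ℝ) =>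
      nearestDist p Q' (s.1 Q', fun j => s.2 (Q', j)) := fun Q' =>
    measurable_nearestDist.comp (hz Q')
  have hx : Measurable fun s : (Band → Config) × (Band × ℕ → ℝ) => (s.1 Q).2 i := by fun_prop
  refine ⟨_, ((hz Q (measurableSet_admissibleSet (p := p) i)).inter (measurableSet_eq_fun (hd Q)
    (hx.dist measurable_const).ennreal_ofReal)).inter
    (((hd Q).prodMk (hd Q.other)) (measurableSet_selectionSet p Q)), rfl⟩

omit [IsProbabilityMeasure P] in
lemma measurableSet_relaySelected (Q : Band) (i : ℕ) :
    MeasurableSet (net.relaySelected p Q i) := by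
  obtain ⟨S, hS, h⟩ := exists_relaySelected_eq_preimage (net := net) (p := p) Q i
  rw [h]
  exact ((measurable_pi_lambda _ fun Q' => hnet.measurable_config Q').prodMk
    (measurable_pi_lambda _ fun k => hnet.measurable_fade _ _ _)) hS

include hp

/-- Given that a relay is selected, its link to the destination succeeds with the probability
`succProb` of its distance, by independence of the fading at the destination. -/
lemma measure_relaySelected_inter (Q : Band) (i : ℕ) :
    P (net.relaySelected p Q i ∩ {ω | p.tau Q < net.linkSNR p Q .dst i ω})
      = ∫⁻ ω in net.relaySelected p Q i,
        ENNReal.ofReal (p.succProb Q (net.admDist p Q ω).toReal) ∂P := by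
  obtain ⟨S, hS, hSe⟩ := exists_relaySelected_eq_preimage (net := net) (p := p) Q i
  have hA : Measurable fun ω => ((fun Q' => net.config Q' ω),
      (fun k : Band × ℕ => net.fade k.1 .src k.2 ω)) :=
    (measurable_pi_lambda _ fun Q' => hnet.measurable_config Q').prodMk
      (measurable_pi_lambda _ fun k => hnet.measurable_fade _ _ _)
  have hB := hnet.measurable_fade Q .dst i
  have hT : MeasurableSet {z : ((Band → Config) × (Band × ℕ → ℝ)) × ℝ |
      z.1 ∈ S ∧ p.tau Q < p.snr Q (dist ((z.1.1 Q).2 i) 0) z.2} := by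
    have hx : Measurable fun z : ((Band → Config) × (Band × ℕ → ℝ)) × ℝ => (z.1.1 Q).2 i := by
      fun_prop
    exact (measurable_fst hS).inter (measurableSet_lt measurable_const
      (measurable_snr.comp ((hx.dist measurable_const).prodMk measurable_snd)))
  have h1 := measure_prodMk_mem_of_indepFun hA hB (indepFun_dstFading hnet Q i) hT
  have h2 : net.relaySelected p Q i ∩ {ω | p.tau Q < net.linkSNR p Q .dst i ω}
      = {ω | (((fun Q' => net.config Q' ω), (fun k : Band × ℕ => net.fade k.1 .src k.2 ω)),
        net.fade Q .dst i ω) ∈ {z : ((Band → Config) × (Band × ℕ → ℝ)) × ℝ |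
          z.1 ∈ S ∧ p.tau Q < p.snr Q (dist ((z.1.1 Q).2 i) 0) z.2}} := by
    rw [hSe]
    rfl
  rw [h2, h1, ← lintegral_indicator (measurableSet_relaySelected hnet Q i)]
  refine lintegral_congr_ae ?_
  filter_upwards [ae_admDist_ne_zero hp hnet] with ω h0
  by_cases hω : ω ∈ net.relaySelected p Q i
  · rw [indicator_of_mem hω]
    have hd : net.admDist p Q ω = ENNReal.ofReal (dist (net.pos Q i ω) 0) := hω.1.2
    have hpos : 0 < dist (net.pos Q i ω) 0 :=
      ENNReal.ofReal_pos.1 (hd ▸ pos_iff_ne_zero.2 (h0 Q))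
    rw [hd, ENNReal.toReal_ofReal dist_nonneg,
      ← measure_tau_lt_snr hp hnet Q .dst i hpos, ofReal_measureReal]
    congr 1
    ext ω'
    rw [hSe] at hω
    exact ⟨fun h => h.2, fun h => ⟨hω, h⟩⟩
  · rw [indicator_of_notMem hω]
    rw [hSe] at hω
    refine measure_mono_null (fun ω' h => ?_) measure_empty
    exact hω h.1

/-- Almost surely, at most one relay of a band is selected. -/
lemma aedisjoint_relaySelected (Q : Band) {i j : ℕ} (hij : i ≠ j) :
    AEDisjoint P (net.relaySelected p Q i) (net.relaySelected p Q j) := by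
  have h : ∀ᵐ ω ∂P, ω ∉ net.relaySelected p Q i ∩ net.relaySelected p Q j := by
    filter_upwards [ae_dist_injective hp hnet Q, ae_admDist_ne_zero hp hnet] with ω hinj h0
    rintro ⟨⟨⟨hi, hdi⟩, -⟩, ⟨⟨hj, hdj⟩, -⟩⟩
    refine hij (hinj i j hi.1 hj.1 (ENNReal.ofReal_pos.1 (hdi ▸ pos_iff_ne_zero.2 (h0 Q))) ?_)
    rw [hdi] at hdj
    exact (ENNReal.ofReal_eq_ofReal_iff dist_nonneg dist_nonneg).1 hdj
  exact measure_eq_zero_iff_ae_notMem.2 h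

/-- Almost surely, the nearest admissible relays of the two bands have different average rates, so
that relays of only one band are selected. -/
lemma aedisjoint_bandSelected :
    AEDisjoint P (net.bandSelected p .rf) (net.bandSelected p .thz) := by
  have h1 := hnet.measurable_admDist (p := p) .rf
  have h2 := hnet.measurable_admDist (p := p) .thz
  have hT : MeasurableSet (selectionSet p .rf ∩ Prod.swap ⁻¹' selectionSet p .thz) :=
    (measurableSet_selectionSet p .rf).inter
      (measurable_swap (measurableSet_selectionSet p .thz))
  have h3 := measure_prodMk_mem_of_indepFun h1 h2 (hnet.indepFun_admDist .rf) hT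
  refine h3.trans ((lintegral_congr_ae ?_).trans lintegral_zero)
  filter_upwards [ae_admDist_ne_zero hp hnet] with ω h0
  rcases eq_or_ne (net.admDist p .rf ω) ∞ with htop | htop
  · exact measure_mono_null (fun ω' h => absurd htop h.1.1) measure_empty
  have hpos := ENNReal.toReal_pos (h0 .rf) htop
  refine measure_mono_null (t := {ω' | net.admDist p .thz ω'
      = ENNReal.ofReal (p.switchDist .rf (net.admDist p .rf ω).toReal)} ∪
      {ω' | net.admDist p .thz ω' = 0}) ?_ (measure_union_null
        (measure_admDist_eq hp hnet .thz ENNReal.ofReal_ne_top)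
        (measure_admDist_eq hp hnet .thz ENNReal.zero_ne_top))
  rintro ω' ⟨⟨-, hle⟩, ⟨htop', hle'⟩⟩
  change net.admDist p .thz ω' ≠ ∞ at htop'
  change net.admDist p .thz ω' = ∞ ∨ _ ≤ _ at hle
  change net.admDist p .rf ω = ∞ ∨ _ ≤ _ at hle'
  have he := le_antisymm (hle.resolve_left htop') (hle'.resolve_left htop)
  rcases eq_or_ne (net.admDist p .thz ω') 0 with hz | hz
  · exact Or.inr hz
  · refine Or.inl ?_
    have hs := hp.meanRate_switchDist .rf hpos
    have h4 := (hp.strictAntiOn_meanRate .thz).injOn (ENNReal.toReal_pos hz htop')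
      (hp.meanSNR_switchDist .rf hpos).1 (he.trans hs.symm)
    change net.admDist p .thz ω' = _
    rw [← h4, ENNReal.ofReal_toReal htop']

/-- The probability that a `Q` relay is selected and covers the destination. -/
lemma measure_band_covered (Q : Band) :
    P (⋃ i, net.relaySelected p Q i ∩ {ω | p.tau Q < net.linkSNR p Q .dst i ω})
      = ∫⁻ ρ, ENNReal.ofReal (p.distPDF Q ρ * p.assocProb Q ρ)
        * ENNReal.ofReal (p.succProb Q |ρ|) := by
  have hms := measurableSet_relaySelected hnet (p := p) Q
  have hd : Pairwise (Function.onFun (AEDisjoint P) fun i => net.relaySelected p Q i) :=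
    fun i j hij => aedisjoint_relaySelected hp hnet Q hij
  have hh : Measurable fun ρ : ℝ => ENNReal.ofReal (p.succProb Q |ρ|) :=
    (hp.continuous_succProb_comp Q continuous_abs abs_nonneg).measurable.ennreal_ofReal
  rw [measure_iUnion₀ (fun i j hij => (hd hij).mono inter_subset_left inter_subset_left)
    fun i => ((hms i).inter (measurableSet_linkSNR hnet Q .dst i)).nullMeasurableSet]
  simp only [measure_relaySelected_inter hp hnet]
  rw [← lintegral_iUnion₀ (fun i => (hms i).nullMeasurableSet) hd, iUnion_relaySelected,
    ← lintegral_bandSelected hp hnet Q hh]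
  simp only [abs_of_nonneg ENNReal.toReal_nonneg]

end Network.IsModel

lemma toReal_setLIntegral_Iic {G : ℝ → ℝ} (hG : Measurable G) (h0 : ∀ ρ, 0 ≤ G ρ)
    (hneg : ∀ ρ ≤ 0, G ρ = 0) {R : ℝ} (hR : 0 ≤ R) :
    (∫⁻ ρ in Iic R, ENNReal.ofReal (G ρ)).toReal = ∫ ρ in (0 : ℝ)..R, G ρ := by
  rw [← integral_eq_lintegral_of_nonneg_ae (ae_of_all _ h0) hG.aestronglyMeasurable,
    intervalIntegral.integral_of_le hR]
  refine setIntegral_eq_of_subset_of_forall_sdiff_eq_zero measurableSet_Iic Ioc_subset_Iic_self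
    fun ρ hρ => hneg ρ ?_
  by_contra h
  exact hρ.2 ⟨not_le.1 h, hρ.1⟩

end HybridRelay

end

open HybridRelay

/-- The first two parts identify `distPDF` as the density of the distance of the nearest admissible
relay, and `assocProb` as the conditional selection probability given this distance. The third is
the formula for the coverage probability. -/
theorem theorem1 {Ω : Type*} [MeasurableSpace Ω] (P : Measure Ω) [IsProbabilityMeasure P]
    (p : HybridRelay.Params) (hp : p.Valid)
    (net : HybridRelay.Network Ω) (hnet : net.IsModel p P) :
    (∀ (Q : HybridRelay.Band) (r : ℝ), 0 ≤ r →
      P.real {ω | ∃ i, net.Admissible p Q i ω ∧ dist (net.pos Q i ω) (p.termPos .dst) ≤ r}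
        = ∫ ρ in (0 : ℝ)..r, p.distPDF Q ρ) ∧
    (∀ (Q : HybridRelay.Band) (r : ℝ), 0 ≤ r →
      P.real {ω | ∃ i, net.Selected p P Q i ω ∧ dist (net.pos Q i ω) (p.termPos .dst) ≤ r}
        = ∫ ρ in (0 : ℝ)..r, p.distPDF Q ρ * p.assocProb Q ρ) ∧
    P.real {ω | net.Covered p P ω} =
      (∫ ρ in (0 : ℝ)..p.RC, p.distPDF .rf ρ
        * Real.exp (-(p.tau .rf * ρ ^ p.beta .rf * p.noise .rf
            / (p.eps .rf * p.gain .rf * p.gam .rf)))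
        * p.assocProb .rf ρ)
      + ∫ ρ in (0 : ℝ)..p.RC, p.distPDF .thz ρ * p.assocProb .thz ρ
        * (1 / Real.Gamma p.mu)
        * HybridRelay.upperGamma p.mu (p.mu * (p.tau .thz * ρ ^ 2 * p.noise .thz
            / (p.eps .thz * p.gain .thz * p.gam .thz * Real.exp (-p.beta .thz * ρ)))
              ^ (p.alpha / 2)) := by
  have hF0 : ∀ Q ρ, 0 ≤ p.distPDF Q ρ * p.assocProb Q ρ := fun Q ρ => by
    rcases le_or_gt ρ 0 with hρ | hρ
    · rw [Params.distPDF_of_nonpos Q hρ, zero_mul]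
    · exact mul_nonneg (hp.distPDF_nonneg Q ρ) (hp.assocProb_nonneg Q hρ)
  have hFm := Network.IsModel.measurable_assocProb_mul hp hnet
  have h0 := Network.IsModel.ae_admDist_ne_zero hp hnet
  have hsel : ∀ᵐ ω ∂P, ∀ Q i, net.Selected p P Q i ω ↔ ω ∈ net.relaySelected p Q i :=
    h0.mono fun ω h Q i => Network.IsModel.selected_iff hp hnet h Q i
  refine ⟨fun Q r hr => ?_, fun Q r hr => ?_, ?_⟩
  · have h1 : {ω | ∃ i, net.Admissible p Q i ω ∧ dist (net.pos Q i ω) (p.termPos .dst) ≤ r}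
        = {ω | net.admDist p Q ω ≤ ENNReal.ofReal r} := by
      ext ω
      exact (nearestDist_le_iff (p := p) (Q := Q)
        (z := (net.config Q ω, net.srcFading Q ω)) hr).symm
    rw [h1, measureReal_def, Network.IsModel.measure_admDist_le hp hnet Q hr,
      ENNReal.toReal_ofReal (intervalIntegral.integral_nonneg hr fun ρ _ => hp.distPDF_nonneg Q ρ)]
  · have hm := (hnet.measurable_admDist (p := p) Q).ennreal_toReal
    have h1 : P {ω | ∃ i, net.Selected p P Q i ω ∧ dist (net.pos Q i ω) (p.termPos .dst) ≤ r}
        = P ((fun ω => (net.admDist p Q ω).toReal) ⁻¹' Iic r ∩ net.bandSelected p Q) := by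
      refine measure_congr ?_
      filter_upwards [hsel] with ω hω
      refine propext ?_
      constructor
      · rintro ⟨i, hi, hd⟩
        have hi' := (hω Q i).1 hi
        refine ⟨?_, hi'.2⟩
        rw [mem_preimage, hi'.1.2, ENNReal.toReal_ofReal dist_nonneg]
        exact hd
      · rintro ⟨hr', hb⟩
        rw [← Network.IsModel.iUnion_relaySelected] at hb
        obtain ⟨i, hi⟩ := mem_iUnion.1 hb
        refine ⟨i, (hω Q i).2 hi, ?_⟩
        rw [mem_preimage, hi.1.2, ENNReal.toReal_ofReal dist_nonneg] at hr'
        exact hr'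
    have h2 := Network.IsModel.lintegral_bandSelected hp hnet Q
      (h := (Iic r).indicator 1) (measurable_one.indicator measurableSet_Iic)
    have h3 : ∫⁻ ω in net.bandSelected p Q, (Iic r).indicator 1 (net.admDist p Q ω).toReal ∂P
        = P ((fun ω => (net.admDist p Q ω).toReal) ⁻¹' Iic r ∩ net.bandSelected p Q) := by
      rw [← Measure.restrict_apply (hm measurableSet_Iic),
        ← lintegral_indicator_one (hm measurableSet_Iic)]
      rfl
    rw [measureReal_def, h1, ← h3, h2,
      ← toReal_setLIntegral_Iic (hFm Q) (hF0 Q)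
        (fun ρ hρ => by rw [Params.distPDF_of_nonpos Q hρ, zero_mul]) hr,
      ← lintegral_indicator measurableSet_Iic]
    congr 1
    refine lintegral_congr fun ρ => ?_
    by_cases h : ρ ∈ Iic r <;> simp [h]
  · have hms : ∀ Q, MeasurableSet
        (⋃ i, net.relaySelected p Q i ∩ {ω | p.tau Q < net.linkSNR p Q .dst i ω}) := fun Q =>
      MeasurableSet.iUnion fun i => (Network.IsModel.measurableSet_relaySelected hnet Q i).inter
        (Network.IsModel.measurableSet_linkSNR hnet Q .dst i)
    have hsub : ∀ Q, (⋃ i, net.relaySelected p Q i ∩ {ω | p.tau Q < net.linkSNR p Q .dst i ω})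
        ⊆ net.bandSelected p Q := fun Q =>
      iUnion_subset fun i => inter_subset_left.trans inter_subset_right
    have h1 : P {ω | net.Covered p P ω}
        = P ((⋃ i, net.relaySelected p .rf i ∩ {ω | p.tau .rf < net.linkSNR p .rf .dst i ω}) ∪
          ⋃ i, net.relaySelected p .thz i ∩ {ω | p.tau .thz < net.linkSNR p .thz .dst i ω}) := by
      refine measure_congr ?_
      filter_upwards [hsel] with ω hω
      refine propext ?_
      constructor
      · rintro ⟨Q, i, hi, hc⟩
        have hi' := (hω Q i).1 hi
        cases Q
        · exact Or.inl (mem_iUnion.2 ⟨i, hi', hc⟩)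
        · exact Or.inr (mem_iUnion.2 ⟨i, hi', hc⟩)
      · rintro (h | h)
        · obtain ⟨i, hi, hc⟩ := mem_iUnion.1 h
          exact ⟨_, i, (hω _ i).2 hi, hc⟩
        · obtain ⟨i, hi, hc⟩ := mem_iUnion.1 h
          exact ⟨_, i, (hω _ i).2 hi, hc⟩
    have h2 : ∀ Q,
        P.real (⋃ i, net.relaySelected p Q i ∩ {ω | p.tau Q < net.linkSNR p Q .dst i ω})
        = ∫ ρ in (0 : ℝ)..p.RC, p.distPDF Q ρ * p.assocProb Q ρ * p.succProb Q |ρ| := fun Q => by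
      have hs : ∀ ρ : ℝ, 0 ≤ p.succProb Q |ρ| := fun ρ => (hp.succProb_mem_Icc Q (abs_nonneg ρ)).1
      have hGm : Measurable fun ρ => p.distPDF Q ρ * p.assocProb Q ρ * p.succProb Q |ρ| :=
        (hFm Q).mul (hp.continuous_succProb_comp Q continuous_abs abs_nonneg).measurable
      rw [measureReal_def, Network.IsModel.measure_band_covered hp hnet Q,
        ← toReal_setLIntegral_Iic hGm (fun ρ => mul_nonneg (hF0 Q ρ) (hs ρ))
          (fun ρ hρ => by simp [Params.distPDF_of_nonpos Q hρ]) hp.RC_pos.le,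
        ← lintegral_indicator measurableSet_Iic]
      congr 1
      refine lintegral_congr fun ρ => ?_
      rw [← ENNReal.ofReal_mul (hF0 Q ρ)]
      by_cases h : ρ ∈ Iic p.RC
      · rw [indicator_of_mem h]
      · have : p.distPDF Q ρ = 0 := if_neg fun hh => h hh.2
        rw [indicator_of_notMem h]
        simp [this]
    have h3 : P.real {ω | net.Covered p P ω} = _ := congrArg ENNReal.toReal h1
    rw [h3]
    change P.real _ = _
    rw [measureReal_union₀ (hms .thz).nullMeasurableSet
      ((Network.IsModel.aedisjoint_bandSelected hp hnet).mono (hsub _) (hsub _)), h2, h2]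
    congr 1
    · refine intervalIntegral.integral_congr fun ρ hρ => ?_
      rw [uIcc_of_le hp.RC_pos.le] at hρ
      simp only [abs_of_nonneg hρ.1, Params.succProb]
      ring
    · refine intervalIntegral.integral_congr fun ρ hρ => ?_
      rw [uIcc_of_le hp.RC_pos.le] at hρ
      simp only [abs_of_nonneg hρ.1, Params.succProb]
      ring
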